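/- Let $H\in(0,\frac12)$, $M<2$, $\gamma\in(0,1]$, $d\in\mathbb N$. Let $W=\{W(t,x):t\in\mathbb R,\ x\in\mathbb R^d\}$ be a (jointly measurable) mean-zero Gaussian random field on a probability space $(\Omega,\mathcal F,P)$ with covariance $$E\big(W(t,x)W(s,y)\big)=\tfrac12\big(|t|^{2H}+|s|^{2H}-|t-s|^{2H}\big)\,Q(x,y),$$ where $Q:\mathbb R^d\times\mathbb R^d\to\mathbb R$ satisfies, for some constants $C_0,C_1>0$ and every $K>0$, (Q1) $Q(x,y)\le C_0(1+K)^M$ whenever $|x|,|y|\le K$; (Q2) $|Q(x,y)-Q(u,v)|\le C_1(1+K)^M\big(|x-u|^\gamma+|y-v|^\gamma\big)$ whenever $|x|,|y|,|u|,|v|\le K$. For a continuous $\phi:[0,T]\to\mathbb R^d$ and $0\le t\le T$, define $$\int_0^tW(ds,\phi_s)=\lim_{\varepsilon\downarrow0}\int_0^t\frac{W(s+\varepsilon,\phi_s)-W(s-\varepsilon,\phi_s)}{2\varepsilon}\,ds,$$ if the limit exists in $L^2(\Omega)$. **Proposition.** Let $0\le t\le T$ and let $\phi,\psi:[0,T]\to\mathbb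 R^d$ be Hölder continuous of order $\alpha$, where $\alpha\gamma>1-2H$. Then the integrals $\int_0^tW(dr,\phi_r)$ and $\int_0^tW(dr,\psi_r)$ exist, the deterministic integrals below converge absolutely, and $$\begin{aligned}E\Big(\int_0^tW(dr,\phi_r)\int_0^tW(dr,\psi_r)\Big)={}&2H\int_0^t\theta^{2H-1}Q(\phi_\theta,\psi_\theta)\,d\theta\\&+H(2H-1)\int_0^t\int_0^\theta r^{2H-2}\big(Q(\phi_\theta,\psi_{\theta-r})-Q(\phi_\theta,\psi_\theta)\big)\,dr\,d\theta\\&+H(2H-1)\int_0^t\int_0^\theta r^{2H-2}\big(Q(\phi_{\theta-r},\psi_\theta)-Q(\phi_\theta,\psi_\theta)\big)\,dr\,d\theta.\end{aligned}$$ -/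

import Mathlib

open MeasureTheory ProbabilityTheory Filter Topology Set
open scoped NNReal ENNReal

namespace NonlinearFBM

/-- Covariance function of the two-sided fractional Brownian motion of Hurst parameter `H`. -/
noncomputable def fbmCov (H t s : ℝ) : ℝ :=
  (1 / 2) * (|t| ^ (2 * H) + |s| ^ (2 * H) - |t - s| ^ (2 * H))

/-- `W = {W(t,x) : t ∈ ℝ, x ∈ ℝ^d}` is a (jointly measurable) centered Gaussian random field on
`(Ω, P)`, fractional of Hurst parameter `H` in time and with spatial covariance `Q`.
Joint measurability makes the pathwise time integrals of `W` meaningful. -/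
structure IsFractionalField {Ω : Type*} [MeasurableSpace Ω] {d : ℕ} (P : Measure Ω)
    (W : ℝ → EuclideanSpace ℝ (Fin d) → Ω → ℝ) (H : ℝ)
    (Q : EuclideanSpace ℝ (Fin d) → EuclideanSpace ℝ (Fin d) → ℝ) : Prop where
  measurable : Measurable
    (fun p : (ℝ × EuclideanSpace ℝ (Fin d)) × Ω => W p.1.1 p.1.2 p.2)
  gaussian : IsGaussianProcess
    (fun (p : ℝ × EuclideanSpace ℝ (Fin d)) (ω : Ω) => W p.1 p.2 ω) P
  mean_zero : ∀ t x, ∫ ω, W t x ω ∂P = 0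
  covariance : ∀ t x s y, ∫ ω, W t x ω * W s y ω ∂P = fbmCov H t s * Q x y

/-- Local boundedness of the spatial covariance, with growth exponent `M`. -/
def LocallyBoundedCov {d : ℕ} (M : ℝ)
    (Q : EuclideanSpace ℝ (Fin d) → EuclideanSpace ℝ (Fin d) → ℝ) : Prop :=
  ∃ C₀ : ℝ, 0 < C₀ ∧ ∀ K : ℝ, 0 < K → ∀ x y, ‖x‖ ≤ K → ‖y‖ ≤ K →
    Q x y ≤ C₀ * (1 + K) ^ M

/-- Local `γ`-Hölder continuity of the spatial covariance, with growth exponent `M`. -/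
def LocallyHolderCov {d : ℕ} (M γ : ℝ)
    (Q : EuclideanSpace ℝ (Fin d) → EuclideanSpace ℝ (Fin d) → ℝ) : Prop :=
  ∃ C₁ : ℝ, 0 < C₁ ∧ ∀ K : ℝ, 0 < K → ∀ x y u v, ‖x‖ ≤ K → ‖y‖ ≤ K → ‖u‖ ≤ K → ‖v‖ ≤ K →
    |Q x y - Q u v| ≤ C₁ * (1 + K) ^ M * (‖x - u‖ ^ γ + ‖y - v‖ ^ γ)

/-- The symmetric difference quotient of `W` in time,
`(W(s+ε,x) - W(s-ε,x)) / (2ε)`. -/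
noncomputable def Wdot {Ω : Type*} {d : ℕ} (W : ℝ → EuclideanSpace ℝ (Fin d) → Ω → ℝ)
    (ε s : ℝ) (x : EuclideanSpace ℝ (Fin d)) (ω : Ω) : ℝ :=
  (1 / (2 * ε)) * (W (s + ε) x ω - W (s - ε) x ω)

/-- The approximating integral of the difference quotient along `φ` over `[0,t]`. -/
noncomputable def approxIntegral {Ω : Type*} {d : ℕ} (W : ℝ → EuclideanSpace ℝ (Fin d) → Ω → ℝ)
    (φ : ℝ → EuclideanSpace ℝ (Fin d)) (t ε : ℝ) (ω : Ω) : ℝ :=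
  ∫ s in (0 : ℝ)..t, Wdot W ε s (φ s) ω

/-- `I` is (a version of) the nonlinear stochastic integral `∫₀ᵗ W(ds, φ_s)`: the limit in
`L²(Ω)` of the approximating integrals as `ε ↓ 0`. -/
def IsNonlinearIntegral {Ω : Type*} [MeasurableSpace Ω] {d : ℕ} (P : Measure Ω)
    (W : ℝ → EuclideanSpace ℝ (Fin d) → Ω → ℝ) (φ : ℝ → EuclideanSpace ℝ (Fin d)) (t : ℝ)
    (I : Ω → ℝ) : Prop :=
  MemLp I 2 P ∧ (∀ ε : ℝ, 0 < ε → MemLp (approxIntegral W φ t ε) 2 P) ∧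
    Tendsto (fun ε : ℝ => eLpNorm (fun ω => approxIntegral W φ t ε ω - I ω) 2 P)
      (𝓝[>] 0) (𝓝 0)

/-- `φ` is Hölder continuous of order `α` on `[0,T]`. -/
def IsHolderPath {d : ℕ} (α : ℝ≥0) (T : ℝ) (φ : ℝ → EuclideanSpace ℝ (Fin d)) : Prop :=
  ∃ C : ℝ≥0, HolderOnWith C α φ (Icc 0 T)

/-- The triangle `{(θ, r) : 0 < r ≤ θ ≤ t}`. -/
def triangle (t : ℝ) : Set (ℝ × ℝ) := {p | 0 < p.2 ∧ p.2 ≤ p.1 ∧ p.1 ≤ t}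

end NonlinearFBM

/-!
The covariance of the symmetric difference quotients of `W` with steps `ε`, `ε'` at times `s`, `r`
is `k(s - r) Q(x, y)`, where `k` is a mixed second difference quotient of `u ↦ |u| ^ (2 * H) / 2`.
Hence the covariance of two regularized integrals is a double integral of `k(s - r) q(s, r)` with
`q(s, r) = Q(φ_s, ψ_r)`. As `k` is even, it splits into the contribution of the diagonal values
`q(θ, θ)`, whose inner integral is an exact difference quotient of `|u| ^ (2 * H)` and tends to
`H θ ^ (2 * H - 1)`, and those of the increments `q(θ, θ - r) - q(θ, θ)` and
`q(θ - r, θ) - q(θ, θ)`. Away from `0`, `k(r)` tends to `H (2 * H - 1) r ^ (2 * H - 2)` and is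
dominated by a multiple of `r ^ (2 * H - 2)`, which the Hölder increments of order `β > 1 - 2 * H`
make integrable. For `r ≤ 2 δ` with `δ = ε + ε'`, the `L¹` norm of `k` is of order
`δ ^ (2 * H - 1)`, so the increments contribute `O(δ ^ (2 * H - 1 + β))`, which vanishes in the
limit.

Since `ε` and `ε'` tend to `0` independently, the limit of the covariances gives both the existence
of the integrals, by Loève's criterion for convergence in `L²`, and their covariance.
-/

namespace NonlinearFBM

section MixedDiffQuot

/-- The mixed second symmetric difference quotient of `f` at `x` with steps `e` and `e'`: the
symmetric difference quotient of step `e` of the symmetric difference quotient of step `e'`. -/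
noncomputable def mixedDiffQuot (f : ℝ → ℝ) (e e' x : ℝ) : ℝ :=
  (f (x + (e + e')) - f (x + (e - e')) - f (x - (e - e')) + f (x - (e + e'))) / (4 * e * e')

variable {f f' f'' : ℝ → ℝ} {e e' x : ℝ}

theorem mixedDiffQuot_eq (f : ℝ → ℝ) (e e' x : ℝ) :
    mixedDiffQuot f e e' x =
      (f (x + e + e') - f (x + e - e') - (f (x - e + e') - f (x - e - e'))) / (4 * e * e') := by
  rw [mixedDiffQuot, show x - (e - e') = x - e + e' by ring]
  simp only [add_assoc, sub_sub, add_sub_assoc]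
  ring

theorem mixedDiffQuot_comm (f : ℝ → ℝ) (e e' x : ℝ) :
    mixedDiffQuot f e e' x = mixedDiffQuot f e' e x := by
  unfold mixedDiffQuot
  rw [show x + (e - e') = x - (e' - e) by ring, show x - (e - e') = x + (e' - e) by ring,
    add_comm e' e]
  ring

theorem even_mixedDiffQuot (hf : Function.Even f) (e e' : ℝ) :
    Function.Even (mixedDiffQuot f e e') := by
  intro x
  unfold mixedDiffQuot
  simp only [← neg_add', neg_add_eq_sub, ← neg_sub x, hf.eq]
  ring

theorem odd_mixedDiffQuot (hf : Function.Odd f) (e e' : ℝ) :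
    Function.Odd (mixedDiffQuot f e e') := by
  intro x
  unfold mixedDiffQuot
  simp only [← neg_add', neg_add_eq_sub, ← neg_sub x, hf.eq]
  ring

theorem continuous_mixedDiffQuot (hf : Continuous f) (e e' : ℝ) :
    Continuous (mixedDiffQuot f e e') := by
  unfold mixedDiffQuot
  fun_prop

theorem hasDerivAt_mixedDiffQuot (hf : ∀ y, HasDerivAt f (f' y) y) (e e' x : ℝ) :
    HasDerivAt (mixedDiffQuot f e e') (mixedDiffQuot f' e e' x) x :=
  ((((hf _).comp_add_const x _).sub ((hf _).comp_add_const x _)).sub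
    ((hf _).comp_sub_const x _)).add ((hf _).comp_sub_const x _) |>.div_const _

theorem exists_mixedDiffQuot_eq (he : 0 < e) (he' : 0 < e')
    (hf : ∀ y ∈ Icc (x - (e + e')) (x + (e + e')), HasDerivAt f (f' y) y)
    (hf' : ∀ y ∈ Icc (x - (e + e')) (x + (e + e')), HasDerivAt f' (f'' y) y) :
    ∃ ξ ∈ Ioo (x - (e + e')) (x + (e + e')), mixedDiffQuot f e e' x = f'' ξ := by
  have hdiff : ∀ y ∈ Icc (x - e) (x + e),
      HasDerivAt (fun y => f (y + e') - f (y - e')) (f' (y + e') - f' (y - e')) y := fun y hy =>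
    ((hf _ ⟨by linarith [hy.1], by linarith [hy.2]⟩).comp_add_const y e').sub
      ((hf _ ⟨by linarith [hy.1], by linarith [hy.2]⟩).comp_sub_const y e')
  obtain ⟨c, hc, hc_eq⟩ := exists_hasDerivAt_eq_slope _ _ (show x - e < x + e by linarith)
    (fun y hy => (hdiff y hy).continuousAt.continuousWithinAt)
    (fun y hy => hdiff y (Ioo_subset_Icc_self hy))
  have hsub : Icc (c - e') (c + e') ⊆ Icc (x - (e + e')) (x + (e + e')) :=
    Icc_subset_Icc (by linarith [hc.1]) (by linarith [hc.2])
  obtain ⟨ξ, hξ, hξ_eq⟩ := exists_hasDerivAt_eq_slope f' f'' (show c - e' < c + e' by linarith)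
    (fun y hy => (hf' y (hsub hy)).continuousAt.continuousWithinAt)
    (fun y hy => hf' y (hsub (Ioo_subset_Icc_self hy)))
  refine ⟨ξ, ⟨by linarith [hξ.1, hc.1], by linarith [hξ.2, hc.2]⟩, ?_⟩
  rw [mixedDiffQuot_eq, hξ_eq, hc_eq, show x + e - (x - e) = 2 * e by ring,
    show c + e' - (c - e') = 2 * e' by ring]
  field_simp
  ring

theorem tendsto_mixedDiffQuot (hf : ∀ᶠ y in 𝓝 x, HasDerivAt f (f' y) y)
    (hf' : ∀ᶠ y in 𝓝 x, HasDerivAt f' (f'' y) y) (hcont : ContinuousAt f'' x) :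
    Tendsto (fun p : ℝ × ℝ => mixedDiffQuot f p.1 p.2 x) (𝓝[>] 0 ×ˢ 𝓝[>] 0) (𝓝 (f'' x)) := by
  rw [Metric.tendsto_nhds]
  intro η hη
  obtain ⟨δ, hδ, hball⟩ := Metric.eventually_nhds_iff_ball.1
    (hf.and (hf'.and (hcont.eventually (Metric.ball_mem_nhds _ hη))))
  have hstep : ∀ᶠ e : ℝ in 𝓝[>] 0, e ∈ Ioo 0 (δ / 2) := Ioo_mem_nhdsGT (half_pos hδ)
  filter_upwards [hstep.prod_mk hstep] with ⟨e, e'⟩ ⟨he, he'⟩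
  have hIcc : Icc (x - (e + e')) (x + (e + e')) ⊆ Metric.ball x δ := by
    rw [Real.ball_eq_Ioo]
    exact Icc_subset_Ioo (by linarith [he.2, he'.2]) (by linarith [he.2, he'.2])
  obtain ⟨ξ, hξ, hξ_eq⟩ := exists_mixedDiffQuot_eq he.1 he'.1
    (fun y hy => (hball y (hIcc hy)).1) (fun y hy => (hball y (hIcc hy)).2.1)
  simpa only [hξ_eq] using (hball ξ (hIcc (Ioo_subset_Icc_self hξ))).2.2

theorem odd_integral_of_even (hf : Function.Even f) :
    Function.Odd fun y => ∫ v in (0 : ℝ)..y, f v := by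
  intro y
  have hreflect := intervalIntegral.integral_comp_neg (a := 0) (b := y) f
  simp only [hf.eq, neg_zero] at hreflect
  exact (intervalIntegral.integral_symm _ _).trans (congrArg Neg.neg hreflect.symm)

theorem integral_mixedDiffQuot (heven : Function.Even f) (hcont : Continuous f) (e e' θ : ℝ) :
    ∫ r in (0 : ℝ)..θ, mixedDiffQuot f e e' r =
      mixedDiffQuot (fun y => ∫ v in (0 : ℝ)..y, f v) e e' θ := by
  rw [intervalIntegral.integral_eq_sub_of_hasDerivAt
    (fun y _ => hasDerivAt_mixedDiffQuot
      (fun z => (hcont.integral_hasStrictDerivAt 0 z).hasDerivAt) e e' y)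
    ((continuous_mixedDiffQuot hcont e e').intervalIntegrable _ _),
    (odd_mixedDiffQuot (odd_integral_of_even heven) e e').map_zero, sub_zero]

theorem apply_le_apply_of_abs_le_abs (heven : Function.Even f) (hmono : MonotoneOn f (Ici 0))
    {y : ℝ} (hxy : |x| ≤ |y|) : f x ≤ f y := by
  have habs : ∀ z, f |z| = f z := fun z => by
    rcases abs_choice z with h | h <;> simp only [h, heven.eq]
  simpa only [habs] using hmono (abs_nonneg x) (abs_nonneg y) hxy

theorem integral_zero_abs_add_sub_sub_le {L h : ℝ} (heven : Function.Even f)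
    (hmono : MonotoneOn f (Ici 0)) (hcont : Continuous f) (hL : 0 ≤ L) (hh : 0 ≤ h) :
    ∫ v in (0 : ℝ)..L, |f (v + h) - f (v - h)| ≤ 2 * h * (f (L + h) - f 0) := by
  have h_int : ∀ a b, IntervalIntegrable f volume a b := hcont.intervalIntegrable
  have hdrop : ∫ v in (0 : ℝ)..L, |f (v + h) - f (v - h)| =
      ∫ v in (0 : ℝ)..L, (f (v + h) - f (v - h)) := by
    refine intervalIntegral.integral_congr fun v hv => abs_of_nonneg (sub_nonneg.2 ?_)
    rw [uIcc_of_le hL] at hv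
    refine apply_le_apply_of_abs_le_abs heven hmono ?_
    rw [abs_of_nonneg (by linarith [hv.1] : 0 ≤ v + h), abs_le]
    constructor <;> linarith [hv.1]
  have hlower : ∫ _ in (-h)..h, f 0 ≤ ∫ v in (-h)..h, f v :=
    intervalIntegral.integral_mono_on (by linarith) intervalIntegrable_const (h_int _ _) fun v _ =>
      apply_le_apply_of_abs_le_abs heven hmono (by simp only [abs_zero, abs_nonneg])
  have hupper : ∫ v in (L - h)..(L + h), f v ≤ ∫ _ in (L - h)..(L + h), f (L + h) := by
    refine intervalIntegral.integral_mono_on (by linarith) (h_int _ _) intervalIntegrable_const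
      fun v hv => apply_le_apply_of_abs_le_abs heven hmono ?_
    rw [abs_of_nonneg (by linarith : 0 ≤ L + h), abs_le]
    constructor <;> linarith [hv.1, hv.2]
  have htelescope : ∫ v in (0 : ℝ)..L, (f (v + h) - f (v - h)) =
      (∫ v in (L - h)..(L + h), f v) - ∫ v in (-h)..h, f v := by
    rw [intervalIntegral.integral_sub (Continuous.intervalIntegrable (by fun_prop) _ _)
      (Continuous.intervalIntegrable (by fun_prop) _ _),
      intervalIntegral.integral_comp_add_right f, intervalIntegral.integral_comp_sub_right f,
      zero_add, zero_sub, intervalIntegral.integral_interval_sub_interval_comm' (h_int _ _)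
      (h_int _ _) (h_int _ _)]
  simp only [intervalIntegral.integral_const, smul_eq_mul] at hlower hupper
  rw [hdrop, htelescope]
  linarith

theorem integral_abs_add_sub_sub_le {L h : ℝ} (heven : Function.Even f)
    (hmono : MonotoneOn f (Ici 0)) (hcont : Continuous f) (hL : 0 ≤ L) (hh : 0 ≤ h) :
    ∫ v in (-L)..L, |f (v + h) - f (v - h)| ≤ 4 * h * (f (L + h) - f 0) := by
  have hneg : ∀ v, |f (-v + h) - f (-v - h)| = |f (v + h) - f (v - h)| := fun v => by
    rw [← heven.eq (v + h), ← heven.eq (v - h), abs_sub_comm]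
    congr 3 <;> ring_nf
  have hreflect := intervalIntegral.integral_comp_neg (a := 0) (b := L)
    (fun v => |f (v + h) - f (v - h)|)
  simp only [hneg, neg_zero] at hreflect
  rw [← intervalIntegral.integral_add_adjacent_intervals (b := 0)
    (Continuous.intervalIntegrable (by fun_prop) _ _)
    (Continuous.intervalIntegrable (by fun_prop) _ _), ← hreflect]
  linarith [integral_zero_abs_add_sub_sub_le heven hmono hcont hL hh]

theorem integral_abs_mixedDiffQuot_le_integral (hcont : Continuous f) (he : 0 < e) (he' : 0 < e')
    {b : ℝ} (hb : 0 ≤ b) :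
    ∫ r in (0 : ℝ)..b, |mixedDiffQuot f e e' r| ≤
      (2 * ∫ v in (-(b + e))..(b + e), |f (v + e') - f (v - e')|) / (4 * e * e') := by
  set g : ℝ → ℝ := fun v => |f (v + e') - f (v - e')|
  have hg : Continuous g := by fun_prop
  have hpoint : ∀ r, |mixedDiffQuot f e e' r| ≤ (g (r + e) + g (r - e)) / (4 * e * e') := by
    intro r
    rw [mixedDiffQuot_eq, abs_div, abs_of_pos (by positivity : 0 < 4 * e * e')]
    gcongr
    exact abs_sub _ _
  have hsub : ∀ u v, -(b + e) ≤ u → u ≤ v → v ≤ b + e →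
      ∫ y in u..v, g y ≤ ∫ y in (-(b + e))..(b + e), g y := fun u v hu huv hv =>
    intervalIntegral.integral_mono_interval hu huv hv (ae_of_all _ fun _ => abs_nonneg _)
      (hg.intervalIntegrable _ _)
  calc ∫ r in (0 : ℝ)..b, |mixedDiffQuot f e e' r|
      ≤ ∫ r in (0 : ℝ)..b, (g (r + e) + g (r - e)) / (4 * e * e') :=
        intervalIntegral.integral_mono_on hb
          ((continuous_mixedDiffQuot hcont e e').abs.intervalIntegrable _ _)
          (Continuous.intervalIntegrable (by fun_prop) _ _) fun r _ => hpoint r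
    _ = ((∫ v in e..(b + e), g v) + ∫ v in (-e)..(b - e), g v) / (4 * e * e') := by
        rw [intervalIntegral.integral_div, intervalIntegral.integral_add
          (Continuous.intervalIntegrable (by fun_prop) _ _)
          (Continuous.intervalIntegrable (by fun_prop) _ _),
          intervalIntegral.integral_comp_add_right g, intervalIntegral.integral_comp_sub_right g,
          zero_add, zero_sub]
    _ ≤ (2 * ∫ v in (-(b + e))..(b + e), g v) / (4 * e * e') := by
        rw [two_mul (∫ v in (-(b + e))..(b + e), g v)]
        gcongr
        · exact hsub _ _ (by linarith) (by linarith) le_rfl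
        · exact hsub _ _ (by linarith) (by linarith) (by linarith)

theorem integral_abs_mixedDiffQuot_le_div_left (heven : Function.Even f)
    (hmono : MonotoneOn f (Ici 0)) (hcont : Continuous f) (he : 0 < e) (he' : 0 < e') {b : ℝ}
    (hb : 0 ≤ b) :
    ∫ r in (0 : ℝ)..b, |mixedDiffQuot f e e' r| ≤ 2 * (f (b + (e + e')) - f 0) / e := calc
  _ ≤ (2 * ∫ v in (-(b + e))..(b + e), |f (v + e') - f (v - e')|) / (4 * e * e') :=
    integral_abs_mixedDiffQuot_le_integral hcont he he' hb
  _ ≤ 2 * (4 * e' * (f (b + e + e') - f 0)) / (4 * e * e') := by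
    gcongr
    exact integral_abs_add_sub_sub_le heven hmono hcont (by positivity) he'.le
  _ = 2 * (f (b + (e + e')) - f 0) / e := by rw [add_assoc]; field_simp

theorem integral_abs_mixedDiffQuot_le (heven : Function.Even f) (hmono : MonotoneOn f (Ici 0))
    (hcont : Continuous f) (he : 0 < e) (he' : 0 < e') {b : ℝ} (hb : 0 ≤ b) :
    ∫ r in (0 : ℝ)..b, |mixedDiffQuot f e e' r| ≤
      4 * (f (b + (e + e')) - f 0) / (e + e') := by
  have hleft := integral_abs_mixedDiffQuot_le_div_left heven hmono hcont he he' hb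
  have hright := integral_abs_mixedDiffQuot_le_div_left heven hmono hcont he' he hb
  simp only [mixedDiffQuot_comm f e' e, add_comm e' e] at hright
  rw [le_div_iff₀ he] at hleft
  rw [le_div_iff₀ he'] at hright
  rw [le_div_iff₀ (by positivity)]
  linarith

end MixedDiffQuot

section FbmKernel

/-- The covariance of the symmetric difference quotients, with steps `e` and `e'`, of a fractional
Brownian motion of Hurst parameter `H` at two times with difference `u`. -/
noncomputable def fbmKernel (H e e' u : ℝ) : ℝ :=
  (1 / 2) * mixedDiffQuot (fun x => |x| ^ (2 * H)) e e' u

variable {H e e' r θ : ℝ}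

theorem even_abs_rpow (p : ℝ) : Function.Even fun x : ℝ => |x| ^ p := fun x => by
  simp only [abs_neg]

theorem continuous_abs_rpow {p : ℝ} (hp : 0 ≤ p) : Continuous fun x : ℝ => |x| ^ p :=
  continuous_abs.rpow_const fun _ => Or.inr hp

theorem monotoneOn_abs_rpow {p : ℝ} (hp : 0 ≤ p) :
    MonotoneOn (fun x : ℝ => |x| ^ p) (Ici 0) := fun _ hx _ _ hxy =>
  Real.rpow_le_rpow (abs_nonneg _) (abs_le_abs_of_nonneg hx hxy) hp

theorem even_fbmKernel (H e e' : ℝ) : Function.Even (fbmKernel H e e') := fun u =>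
  congrArg (1 / 2 * ·) (even_mixedDiffQuot (even_abs_rpow _) e e' u)

theorem continuous_fbmKernel (hH : 0 ≤ H) (e e' : ℝ) : Continuous (fbmKernel H e e') :=
  continuous_const.mul (continuous_mixedDiffQuot (continuous_abs_rpow (by positivity)) e e')

theorem hasDerivAt_abs_rpow {p y : ℝ} (hy : 0 < y) :
    HasDerivAt (fun x : ℝ => |x| ^ p) (p * y ^ (p - 1)) y :=
  (Real.hasDerivAt_rpow_const (Or.inl hy.ne')).congr_of_eventuallyEq <| by
    filter_upwards [lt_mem_nhds hy] with z hz
    rw [abs_of_pos hz]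

theorem hasDerivAt_const_mul_rpow {p y : ℝ} (hy : 0 < y) :
    HasDerivAt (fun x : ℝ => p * x ^ (p - 1)) (p * (p - 1) * y ^ (p - 2)) y := by
  have h := (Real.hasDerivAt_rpow_const (x := y) (p := p - 1) (Or.inl hy.ne')).const_mul p
  rwa [show p - 1 - 1 = p - 2 by ring, ← mul_assoc] at h

theorem rpow_le_two_rpow_abs_mul_rpow {x y : ℝ} (hx : 0 < x) (hxy : x / 2 ≤ y) (hyx : y ≤ 2 * x)
    (p : ℝ) : y ^ p ≤ 2 ^ |p| * x ^ p := by
  rcases le_total 0 p with hp | hp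
  · rw [abs_of_nonneg hp, ← Real.mul_rpow zero_le_two hx.le]
    exact Real.rpow_le_rpow (by linarith) hyx hp
  · calc y ^ p ≤ (x / 2) ^ p := Real.rpow_le_rpow_of_nonpos (by positivity) hxy hp
      _ = 2 ^ |p| * x ^ p := by
        rw [abs_of_nonpos hp, Real.div_rpow hx.le zero_le_two, Real.rpow_neg zero_le_two]
        ring

theorem tendsto_fbmKernel (H : ℝ) (hr : 0 < r) :
    Tendsto (fun p : ℝ × ℝ => fbmKernel H p.1 p.2 r) (𝓝[>] 0 ×ˢ 𝓝[>] 0)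
      (𝓝 (H * (2 * H - 1) * r ^ (2 * H - 2))) := by
  have h := (tendsto_mixedDiffQuot (f := fun x => |x| ^ (2 * H))
    ((lt_mem_nhds hr).mono fun _ => hasDerivAt_abs_rpow)
    ((lt_mem_nhds hr).mono fun _ => hasDerivAt_const_mul_rpow)
    (continuousAt_const.mul (Real.continuousAt_rpow_const _ _ (Or.inl hr.ne')))).const_mul (1 / 2)
  rwa [show 1 / 2 * (2 * H * (2 * H - 1) * r ^ (2 * H - 2)) =
    H * (2 * H - 1) * r ^ (2 * H - 2) by ring] at h

theorem abs_fbmKernel_le (hH : 0 ≤ H) (hH' : H ≤ 1) (he : 0 < e) (he' : 0 < e')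
    (hr : 2 * (e + e') ≤ r) : |fbmKernel H e e' r| ≤ 4 * r ^ (2 * H - 2) := by
  have hr0 : 0 < r := by linarith
  obtain ⟨ξ, hξ, hξ_eq⟩ := exists_mixedDiffQuot_eq (f := fun x => |x| ^ (2 * H)) (x := r) he he'
    (fun y hy => hasDerivAt_abs_rpow (by linarith [hy.1]))
    (fun y hy => hasDerivAt_const_mul_rpow (by linarith [hy.1]))
  have hcoeff : |H * (2 * H - 1)| ≤ 1 := by rw [abs_le]; constructor <;> nlinarith
  have hξ_pow : 0 ≤ ξ ^ (2 * H - 2) := Real.rpow_nonneg (by linarith [hξ.1]) _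
  calc |fbmKernel H e e' r| = |H * (2 * H - 1) * ξ ^ (2 * H - 2)| := by
        rw [fbmKernel, hξ_eq]
        congr 1
        ring
    _ = |H * (2 * H - 1)| * ξ ^ (2 * H - 2) := by rw [abs_mul, abs_of_nonneg hξ_pow]
    _ ≤ 1 * (2 ^ |2 * H - 2| * r ^ (2 * H - 2)) := by
        gcongr
        exact rpow_le_two_rpow_abs_mul_rpow hr0 (by linarith [hξ.1]) (by linarith [hξ.2]) _
    _ ≤ 1 * (2 ^ (2 : ℝ) * r ^ (2 * H - 2)) := by
        gcongr
        · exact one_le_two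
        · rw [abs_le]; constructor <;> linarith
    _ = 4 * r ^ (2 * H - 2) := by norm_num

theorem integral_abs_fbmKernel_le (hH : 0 ≤ H) (hH' : H ≤ 1) (he : 0 < e) (he' : 0 < e') :
    ∫ r in (0 : ℝ)..2 * (e + e'), |fbmKernel H e e' r| ≤ 18 * (e + e') ^ (2 * H - 1) := by
  have hH2 : 0 ≤ 2 * H := by positivity
  set δ := e + e'
  have hδ : 0 < δ := add_pos he he'
  have hbound := integral_abs_mixedDiffQuot_le (even_abs_rpow (2 * H)) (monotoneOn_abs_rpow hH2)
    (continuous_abs_rpow hH2) he he' (show 0 ≤ 2 * δ by positivity)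
  calc ∫ r in (0 : ℝ)..2 * δ, |fbmKernel H e e' r|
      = 1 / 2 * ∫ r in (0 : ℝ)..2 * δ, |mixedDiffQuot (fun x => |x| ^ (2 * H)) e e' r| := by
        simp only [fbmKernel, abs_mul, abs_of_pos (one_half_pos (α := ℝ)),
          intervalIntegral.integral_const_mul]
    _ ≤ 1 / 2 * (4 * (|2 * δ + δ| ^ (2 * H) - |0| ^ (2 * H)) / δ) := by gcongr
    _ ≤ 1 / 2 * (4 * ((3 ^ (2 : ℝ) * δ ^ (2 * H)) - 0) / δ) := by
        gcongr
        · rw [show 2 * δ + δ = 3 * δ by ring, abs_of_pos (by positivity),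
            Real.mul_rpow (by norm_num) hδ.le]
          gcongr
          · norm_num
          · linarith
        · positivity
    _ = 18 * δ ^ (2 * H - 1) := by
        rw [Real.rpow_sub_one hδ.ne']
        norm_num
        ring

theorem integral_fbmKernel (hH : 0 ≤ H) (e e' θ : ℝ) :
    ∫ r in (0 : ℝ)..θ, fbmKernel H e e' r =
      (1 / 2) * mixedDiffQuot (fun y => ∫ x in (0 : ℝ)..y, |x| ^ (2 * H)) e e' θ := by
  simp only [fbmKernel, intervalIntegral.integral_const_mul]
  rw [integral_mixedDiffQuot (even_abs_rpow _) (continuous_abs_rpow (by positivity))]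

theorem hasDerivAt_integral_abs_rpow {p : ℝ} (hp : 0 ≤ p) (y : ℝ) :
    HasDerivAt (fun y => ∫ x in (0 : ℝ)..y, |x| ^ p) (|y| ^ p) y :=
  ((continuous_abs_rpow hp).integral_hasStrictDerivAt 0 y).hasDerivAt

theorem tendsto_integral_fbmKernel (hH : 0 ≤ H) (hθ : 0 < θ) :
    Tendsto (fun p : ℝ × ℝ => ∫ r in (0 : ℝ)..θ, fbmKernel H p.1 p.2 r) (𝓝[>] 0 ×ˢ 𝓝[>] 0)
      (𝓝 (H * θ ^ (2 * H - 1))) := by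
  simp only [integral_fbmKernel hH]
  have h := (tendsto_mixedDiffQuot
    (Eventually.of_forall (hasDerivAt_integral_abs_rpow (by positivity : 0 ≤ 2 * H)))
    ((lt_mem_nhds hθ).mono fun _ => hasDerivAt_abs_rpow)
    (continuousAt_const.mul (Real.continuousAt_rpow_const _ _ (Or.inl hθ.ne')))).const_mul (1 / 2)
  rwa [show 1 / 2 * (2 * H * θ ^ (2 * H - 1)) = H * θ ^ (2 * H - 1) by ring] at h

theorem rpow_two_mul_sub_one_le {δ : ℝ} (hH : 0 ≤ H) (hθ : 0 < θ) (hδ : δ ≤ 1)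
    (hθδ : θ ≤ 2 * δ) : δ ^ (2 * H - 1) ≤ 2 * (θ ^ (2 * H - 1) + 1) := by
  have hθ_pow : 0 ≤ θ ^ (2 * H - 1) := Real.rpow_nonneg hθ.le _
  rcases le_total H (1 / 2) with hH' | hH'
  · calc δ ^ (2 * H - 1) ≤ (θ / 2) ^ (2 * H - 1) :=
          Real.rpow_le_rpow_of_nonpos (by positivity) (by linarith) (by linarith)
      _ ≤ 2 ^ |2 * H - 1| * θ ^ (2 * H - 1) :=
          rpow_le_two_rpow_abs_mul_rpow hθ le_rfl (by linarith) _
      _ ≤ 2 ^ (1 : ℝ) * θ ^ (2 * H - 1) := by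
          gcongr
          · exact one_le_two
          · rw [abs_le]; constructor <;> linarith
      _ ≤ 2 * (θ ^ (2 * H - 1) + 1) := by rw [Real.rpow_one]; linarith
  · linarith [Real.rpow_le_one (by linarith : 0 ≤ δ) hδ (by linarith : 0 ≤ 2 * H - 1)]

theorem abs_integral_fbmKernel_le_of_le (hH : 0 ≤ H) (hH' : H ≤ 1) (he : 0 < e) (he' : 0 < e')
    (hθ : 0 ≤ θ) (hle : θ ≤ 2 * (e + e')) :
    |∫ r in (0 : ℝ)..θ, fbmKernel H e e' r| ≤ 18 * (e + e') ^ (2 * H - 1) := calc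
  _ ≤ ∫ r in (0 : ℝ)..θ, |fbmKernel H e e' r| :=
    intervalIntegral.abs_integral_le_integral_abs hθ
  _ ≤ ∫ r in (0 : ℝ)..2 * (e + e'), |fbmKernel H e e' r| :=
    intervalIntegral.integral_mono_interval le_rfl hθ hle (ae_of_all _ fun _ => abs_nonneg _)
      ((continuous_fbmKernel hH e e').abs.intervalIntegrable _ _)
  _ ≤ 18 * (e + e') ^ (2 * H - 1) := integral_abs_fbmKernel_le hH hH' he he'

theorem abs_integral_fbmKernel_le_of_ge (hH : 0 ≤ H) (hH' : H ≤ 1) (he : 0 < e) (he' : 0 < e')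
    (hge : 2 * (e + e') ≤ θ) :
    |∫ r in (0 : ℝ)..θ, fbmKernel H e e' r| ≤ 2 * θ ^ (2 * H - 1) := by
  obtain ⟨ξ, hξ, hξ_eq⟩ := exists_mixedDiffQuot_eq (x := θ) he he'
    (fun y _ => hasDerivAt_integral_abs_rpow (by positivity : 0 ≤ 2 * H) y)
    (fun y hy => hasDerivAt_abs_rpow (by linarith [hy.1]))
  have hξ_pow : 0 ≤ ξ ^ (2 * H - 1) := Real.rpow_nonneg (by linarith [hξ.1]) _
  calc |∫ r in (0 : ℝ)..θ, fbmKernel H e e' r| = H * ξ ^ (2 * H - 1) := by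
        rw [integral_fbmKernel hH, hξ_eq, abs_of_nonneg (by positivity)]
        ring
    _ ≤ 1 * (2 ^ |2 * H - 1| * θ ^ (2 * H - 1)) := by
        gcongr
        exact rpow_le_two_rpow_abs_mul_rpow (by linarith) (by linarith [hξ.1])
          (by linarith [hξ.2]) _
    _ ≤ 1 * (2 ^ (1 : ℝ) * θ ^ (2 * H - 1)) := by
        have : 0 ≤ θ := by linarith
        gcongr
        · exact one_le_two
        · rw [abs_le]; constructor <;> linarith
    _ = 2 * θ ^ (2 * H - 1) := by rw [Real.rpow_one, one_mul]

theorem abs_integral_fbmKernel_le (hH : 0 ≤ H) (hH' : H ≤ 1) (he : 0 < e) (he' : 0 < e')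
    (hle : e + e' ≤ 1) (hθ : 0 < θ) :
    |∫ r in (0 : ℝ)..θ, fbmKernel H e e' r| ≤ 36 * (θ ^ (2 * H - 1) + 1) := by
  have hθ_pow : 0 ≤ θ ^ (2 * H - 1) := Real.rpow_nonneg hθ.le _
  rcases le_total θ (2 * (e + e')) with h | h
  · linarith [abs_integral_fbmKernel_le_of_le hH hH' he he' hθ.le h,
      rpow_two_mul_sub_one_le hH hθ hle h]
  · linarith [abs_integral_fbmKernel_le_of_ge hH hH' he he' h]

end FbmKernel

section TriangleIntegral

variable {a b c t : ℝ}

theorem integral_indicator_Ici (hac : a ≤ c) (hcb : c ≤ b) (f : ℝ → ℝ) :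
    ∫ x in a..b, (Ici c).indicator f x = ∫ x in c..b, f x := by
  rw [intervalIntegral.integral_of_le (hac.trans hcb), intervalIntegral.integral_of_le hcb,
    integral_indicator measurableSet_Ici, Measure.restrict_restrict measurableSet_Ici]
  rw [← sup_eq_right.2 hac, ← Ioc_inter_Ioi, sup_eq_right.2 hac, inter_comm]
  exact setIntegral_congr_set ((ae_eq_refl _).inter Ioi_ae_eq_Ici.symm)

theorem integral_integral_triangle_swap {h : ℝ → ℝ → ℝ} (hh : Continuous (Function.uncurry h))
    (ht : 0 ≤ t) :
    ∫ s in (0 : ℝ)..t, ∫ r in s..t, h s r = ∫ r in (0 : ℝ)..t, ∫ s in (0 : ℝ)..r, h s r := by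
  set F : ℝ → ℝ → ℝ := fun s r => {p : ℝ × ℝ | p.1 ≤ p.2}.indicator (Function.uncurry h) (s, r)
  have hF : IntegrableOn F.uncurry (uIoc 0 t ×ˢ uIoc 0 t) :=
    ((hh.continuousOn.integrableOn_compact (isCompact_uIcc.prod isCompact_uIcc)).mono_set
      (prod_mono uIoc_subset_uIcc uIoc_subset_uIcc)).indicator
      (measurableSet_le measurable_fst measurable_snd)
  calc ∫ s in (0 : ℝ)..t, ∫ r in s..t, h s r
      = ∫ s in (0 : ℝ)..t, ∫ r in (0 : ℝ)..t, F s r := by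
        refine intervalIntegral.integral_congr fun s hs => ?_
        rw [uIcc_of_le ht] at hs
        exact (integral_indicator_Ici hs.1 hs.2 (h s)).symm
    _ = ∫ r in (0 : ℝ)..t, ∫ s in (0 : ℝ)..t, F s r := intervalIntegral_intervalIntegral_swap hF
    _ = ∫ r in (0 : ℝ)..t, ∫ s in (0 : ℝ)..r, h s r := by
        refine intervalIntegral.integral_congr fun r hr => ?_
        rw [uIcc_of_le ht] at hr
        exact intervalIntegral.integral_indicator (f := fun s => h s r) hr

theorem continuous_integral_zero_self {k : ℝ → ℝ → ℝ} (hk : Continuous (Function.uncurry k)) :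
    Continuous fun θ => ∫ r in (0 : ℝ)..θ, k θ r :=
  intervalIntegral.continuous_parametric_intervalIntegral_of_continuous hk continuous_id

theorem integral_integral_eq_add_triangles {h : ℝ → ℝ → ℝ}
    (hh : Continuous (Function.uncurry h)) (ht : 0 ≤ t) :
    ∫ s in (0 : ℝ)..t, ∫ r in (0 : ℝ)..t, h s r =
      (∫ θ in (0 : ℝ)..t, ∫ r in (0 : ℝ)..θ, h θ (θ - r)) +
        ∫ θ in (0 : ℝ)..t, ∫ r in (0 : ℝ)..θ, h (θ - r) θ := by
  have hslice : ∀ s, Continuous (h s) := fun s => by fun_prop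
  have hupper : Continuous fun s => ∫ r in s..t, h s r := by
    simp only [fun s => intervalIntegral.integral_symm (f := h s) (μ := volume) t s]
    exact (intervalIntegral.continuous_parametric_intervalIntegral_of_continuous hh
      continuous_id).neg
  calc ∫ s in (0 : ℝ)..t, ∫ r in (0 : ℝ)..t, h s r
      = ∫ s in (0 : ℝ)..t, ((∫ r in (0 : ℝ)..s, h s r) + ∫ r in s..t, h s r) :=
        intervalIntegral.integral_congr fun s _ =>
          (intervalIntegral.integral_add_adjacent_intervals
            ((hslice s).intervalIntegrable _ _) ((hslice s).intervalIntegrable _ _)).symm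
    _ = (∫ θ in (0 : ℝ)..t, ∫ r in (0 : ℝ)..θ, h θ r) +
          ∫ θ in (0 : ℝ)..t, ∫ r in (0 : ℝ)..θ, h r θ := by
        rw [intervalIntegral.integral_add
          ((continuous_integral_zero_self hh).intervalIntegrable _ _)
          (hupper.intervalIntegrable _ _), integral_integral_triangle_swap hh ht]
    _ = _ := by
        simp only [fun θ => intervalIntegral.integral_comp_sub_left (a := 0) (b := θ)
          (fun r => h θ r) θ, fun θ => intervalIntegral.integral_comp_sub_left (a := 0) (b := θ)
          (fun r => h r θ) θ, sub_self, sub_zero]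

theorem integral_integral_even_sub_mul {V : ℝ → ℝ} {q : ℝ → ℝ → ℝ} (hV : Function.Even V)
    (hVc : Continuous V) (hq : Continuous (Function.uncurry q)) (ht : 0 ≤ t) :
    ∫ s in (0 : ℝ)..t, ∫ r in (0 : ℝ)..t, V (s - r) * q s r =
      2 * (∫ θ in (0 : ℝ)..t, (∫ r in (0 : ℝ)..θ, V r) * q θ θ)
        + (∫ θ in (0 : ℝ)..t, ∫ r in (0 : ℝ)..θ, V r * (q θ (θ - r) - q θ θ))
        + ∫ θ in (0 : ℝ)..t, ∫ r in (0 : ℝ)..θ, V r * (q (θ - r) θ - q θ θ) := by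
  have hsplit : ∀ k : ℝ → ℝ → ℝ, Continuous (Function.uncurry k) →
      ∫ θ in (0 : ℝ)..t, ∫ r in (0 : ℝ)..θ, V r * k θ r =
        (∫ θ in (0 : ℝ)..t, (∫ r in (0 : ℝ)..θ, V r) * q θ θ) +
          ∫ θ in (0 : ℝ)..t, ∫ r in (0 : ℝ)..θ, V r * (k θ r - q θ θ) := by
    intro k hk
    have hdiag : Continuous fun θ => (∫ r in (0 : ℝ)..θ, V r) * q θ θ :=
      (intervalIntegral.continuous_primitive (fun _ _ => hVc.intervalIntegrable _ _) 0).mul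
        (by fun_prop)
    have hincr : Continuous (Function.uncurry fun θ r => V r * (k θ r - q θ θ)) := by fun_prop
    rw [← intervalIntegral.integral_add (hdiag.intervalIntegrable _ _)
      ((continuous_integral_zero_self hincr).intervalIntegrable _ _)]
    refine intervalIntegral.integral_congr fun θ _ => ?_
    rw [← intervalIntegral.integral_mul_const, ← intervalIntegral.integral_add
      (Continuous.intervalIntegrable (by fun_prop) _ _)
      (Continuous.intervalIntegrable (by fun_prop) _ _)]
    exact intervalIntegral.integral_congr fun r _ => by ring
  rw [integral_integral_eq_add_triangles (h := fun s r => V (s - r) * q s r) (by fun_prop) ht]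
  simp only [sub_sub_cancel, sub_sub_cancel_left, hV.eq]
  rw [hsplit (fun θ r => q θ (θ - r)) (by fun_prop), hsplit (fun θ r => q (θ - r) θ) (by fun_prop)]
  ring

end TriangleIntegral

section KernelIntegral

variable {H e e' r θ t : ℝ} {C β : ℝ≥0} {g : ℝ → ℝ}

theorem abs_integral_fbmKernel_mul_le_of_le (hH : 0 ≤ H) (hH' : H ≤ 1) (he : 0 < e) (he' : 0 < e')
    (hgc : Continuous g) (hg : ∀ r, 0 ≤ r → |g r| ≤ C * r ^ (β : ℝ)) (hθ : 0 ≤ θ)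
    (hle : θ ≤ 2 * (e + e')) :
    |∫ r in (0 : ℝ)..θ, fbmKernel H e e' r * g r| ≤
      18 * 2 ^ (β : ℝ) * C * (e + e') ^ (β + 2 * H - 1) := by
  have hK := continuous_fbmKernel hH e e'
  have hδ : 0 < e + e' := add_pos he he'
  calc |∫ r in (0 : ℝ)..θ, fbmKernel H e e' r * g r|
      ≤ ∫ r in (0 : ℝ)..θ, |fbmKernel H e e' r * g r| :=
        intervalIntegral.abs_integral_le_integral_abs hθ
    _ ≤ ∫ r in (0 : ℝ)..θ, |fbmKernel H e e' r| * (C * (2 * (e + e')) ^ (β : ℝ)) := by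
        refine intervalIntegral.integral_mono_on hθ ((hK.mul hgc).abs.intervalIntegrable _ _)
          ((hK.abs.mul continuous_const).intervalIntegrable _ _) fun r hr => ?_
        rw [abs_mul]
        have hr0 := hr.1
        have hr_le := hr.2.trans hle
        exact mul_le_mul_of_nonneg_left ((hg r hr0).trans (by gcongr)) (abs_nonneg _)
    _ ≤ ∫ r in (0 : ℝ)..2 * (e + e'), |fbmKernel H e e' r| * (C * (2 * (e + e')) ^ (β : ℝ)) :=
        intervalIntegral.integral_mono_interval le_rfl hθ hle (ae_of_all _ fun _ => by
          simp only [Pi.zero_apply]; positivity)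
          ((hK.abs.mul continuous_const).intervalIntegrable _ _)
    _ = (∫ r in (0 : ℝ)..2 * (e + e'), |fbmKernel H e e' r|) * (C * (2 * (e + e')) ^ (β : ℝ)) :=
        intervalIntegral.integral_mul_const _ _
    _ ≤ 18 * (e + e') ^ (2 * H - 1) * (C * (2 * (e + e')) ^ (β : ℝ)) := by
        gcongr
        exact integral_abs_fbmKernel_le hH hH' he he'
    _ = 18 * 2 ^ (β : ℝ) * C * (e + e') ^ (β + 2 * H - 1) := by
        rw [Real.mul_rpow zero_le_two hδ.le, add_sub_assoc, Real.rpow_add hδ]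
        ring

theorem abs_fbmKernel_mul_le (hH : 0 ≤ H) (hH' : H ≤ 1) (he : 0 < e) (he' : 0 < e')
    (hg : ∀ r, 0 ≤ r → |g r| ≤ C * r ^ (β : ℝ)) (hr : 2 * (e + e') ≤ r) :
    |fbmKernel H e e' r * g r| ≤ 4 * C * r ^ (2 * H - 2 + β) := by
  have hr0 : 0 < r := by linarith
  calc |fbmKernel H e e' r * g r| = |fbmKernel H e e' r| * |g r| := abs_mul _ _
    _ ≤ 4 * r ^ (2 * H - 2) * (C * r ^ (β : ℝ)) := by
        gcongr
        · exact abs_fbmKernel_le hH hH' he he' hr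
        · exact hg r hr0.le
    _ = 4 * C * r ^ (2 * H - 2 + β) := by
        rw [Real.rpow_add hr0]
        ring

theorem abs_integral_fbmKernel_mul_le (hH : 0 ≤ H) (hH' : H ≤ 1) (hβ : 1 - 2 * H < β)
    (he : 0 < e) (he' : 0 < e') (hgc : Continuous g)
    (hg : ∀ r, 0 ≤ r → |g r| ≤ C * r ^ (β : ℝ)) (hθ : 0 ≤ θ) (hθt : θ ≤ t) :
    |∫ r in (0 : ℝ)..θ, fbmKernel H e e' r * g r| ≤
      18 * 2 ^ (β : ℝ) * C * (e + e') ^ (β + 2 * H - 1) +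
        ∫ r in (0 : ℝ)..t, 4 * C * r ^ (2 * H - 2 + β) := by
  set b := min θ (2 * (e + e'))
  have hb0 : 0 ≤ b := le_min hθ (by positivity)
  have h_int : ∀ x y, IntervalIntegrable (fun r => fbmKernel H e e' r * g r) volume x y :=
    ((continuous_fbmKernel hH e e').mul hgc).intervalIntegrable
  have hdom : ∀ x y, IntervalIntegrable (fun r => 4 * C * r ^ (2 * H - 2 + β)) volume x y :=
    fun x y => (intervalIntegral.intervalIntegrable_rpow' (by linarith)).const_mul _
  have hfar : |∫ r in b..θ, fbmKernel H e e' r * g r| ≤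
      ∫ r in (0 : ℝ)..t, 4 * C * r ^ (2 * H - 2 + β) := calc
    _ ≤ ∫ r in b..θ, 4 * C * r ^ (2 * H - 2 + β) := by
      rw [← Real.norm_eq_abs]
      refine intervalIntegral.norm_integral_le_of_norm_le (min_le_left _ _)
        (ae_of_all _ fun r hr => ?_) (hdom _ _)
      rcases min_lt_iff.1 hr.1 with h | h
      · exact absurd hr.2 h.not_ge
      · exact abs_fbmKernel_mul_le hH hH' he he' hg h.le
    _ ≤ _ := by
      refine intervalIntegral.integral_mono_interval hb0 (min_le_left _ _) hθt ?_ (hdom _ _)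
      refine (ae_restrict_iff' measurableSet_Ioc).2 (ae_of_all _ fun r hr => ?_)
      exact mul_nonneg (by positivity) (Real.rpow_nonneg hr.1.le _)
  rw [← intervalIntegral.integral_add_adjacent_intervals (h_int 0 b) (h_int b θ)]
  exact (abs_add_le _ _).trans (add_le_add (abs_integral_fbmKernel_mul_le_of_le hH hH' he he' hgc
    hg hb0 (min_le_right _ _)) hfar)

theorem tendsto_add_nhdsGT_prod :
    Tendsto (fun p : ℝ × ℝ => p.1 + p.2) (𝓝[>] 0 ×ˢ 𝓝[>] 0) (𝓝 0) := by
  have hfst : Tendsto (fun p : ℝ × ℝ => p.1) (𝓝[>] (0 : ℝ) ×ˢ 𝓝[>] 0) (𝓝 0) :=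
    tendsto_fst.mono_right nhdsWithin_le_nhds
  have hsnd : Tendsto (fun p : ℝ × ℝ => p.2) (𝓝[>] (0 : ℝ) ×ˢ 𝓝[>] 0) (𝓝 0) :=
    tendsto_snd.mono_right nhdsWithin_le_nhds
  simpa only [add_zero] using hfst.add hsnd

theorem eventually_pos_prod : ∀ᶠ p : ℝ × ℝ in 𝓝[>] 0 ×ˢ 𝓝[>] 0, 0 < p.1 ∧ 0 < p.2 :=
  (eventually_mem_nhdsWithin (s := Ioi (0 : ℝ))).prod_mk eventually_mem_nhdsWithin

theorem eventually_two_mul_add_le (hr : 0 < r) :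
    ∀ᶠ p : ℝ × ℝ in 𝓝[>] 0 ×ˢ 𝓝[>] 0, 2 * (p.1 + p.2) ≤ r := by
  filter_upwards [tendsto_add_nhdsGT_prod.eventually (gt_mem_nhds (half_pos hr))] with p hp
  linarith

theorem tendsto_integral_far_fbmKernel_mul (hH : 0 ≤ H) (hH' : H ≤ 1) (hβ : 1 - 2 * H < β)
    (hgc : Continuous g) (hg : ∀ r, 0 ≤ r → |g r| ≤ C * r ^ (β : ℝ)) (hθ : 0 < θ) :
    Tendsto (fun p : ℝ × ℝ => ∫ r in 2 * (p.1 + p.2)..θ, fbmKernel H p.1 p.2 r * g r)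
      (𝓝[>] 0 ×ˢ 𝓝[>] 0)
      (𝓝 (H * (2 * H - 1) * ∫ r in (0 : ℝ)..θ, r ^ (2 * H - 2) * g r)) := by
  set F : ℝ × ℝ → ℝ → ℝ := fun p =>
    (Ici (2 * (p.1 + p.2))).indicator fun r => fbmKernel H p.1 p.2 r * g r
  have hF : Tendsto (fun p => ∫ r in (0 : ℝ)..θ, F p r) (𝓝[>] 0 ×ˢ 𝓝[>] 0)
      (𝓝 (∫ r in (0 : ℝ)..θ, H * (2 * H - 1) * (r ^ (2 * H - 2) * g r))) := by
    refine intervalIntegral.tendsto_integral_filter_of_dominated_convergence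
      (fun r => 4 * C * r ^ (2 * H - 2 + β)) (Eventually.of_forall fun p => ?_) ?_
      ((intervalIntegral.intervalIntegrable_rpow' (by linarith)).const_mul _)
      (ae_of_all _ fun r hr => ?_)
    · exact (((continuous_fbmKernel hH _ _).mul hgc).measurable.indicator
        measurableSet_Ici).aestronglyMeasurable
    · filter_upwards [eventually_pos_prod] with p hp
      refine ae_of_all _ fun r hr => ?_
      rw [uIoc_of_le hθ.le] at hr
      by_cases hpr : r ∈ Ici (2 * (p.1 + p.2))
      · simp only [F, indicator_of_mem hpr]
        exact abs_fbmKernel_mul_le hH hH' hp.1 hp.2 hg hpr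
      · simp only [F, indicator_of_notMem hpr, norm_zero]
        exact mul_nonneg (by positivity) (Real.rpow_nonneg hr.1.le _)
    · rw [uIoc_of_le hθ.le] at hr
      rw [← mul_assoc]
      refine ((tendsto_fbmKernel H hr.1).mul_const (g r)).congr' ?_
      filter_upwards [eventually_two_mul_add_le hr.1] with p hp
      exact (indicator_of_mem (mem_Ici.2 hp) fun r => fbmKernel H p.1 p.2 r * g r).symm
  rw [intervalIntegral.integral_const_mul] at hF
  refine hF.congr' ?_
  filter_upwards [eventually_pos_prod, eventually_two_mul_add_le hθ] with p hp hpθ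
  exact integral_indicator_Ici (by linarith [hp.1, hp.2]) hpθ _

theorem tendsto_integral_fbmKernel_mul (hH : 0 ≤ H) (hH' : H ≤ 1) (hβ : 1 - 2 * H < β)
    (hgc : Continuous g) (hg : ∀ r, 0 ≤ r → |g r| ≤ C * r ^ (β : ℝ)) (hθ : 0 < θ) :
    Tendsto (fun p : ℝ × ℝ => ∫ r in (0 : ℝ)..θ, fbmKernel H p.1 p.2 r * g r)
      (𝓝[>] 0 ×ˢ 𝓝[>] 0)
      (𝓝 (H * (2 * H - 1) * ∫ r in (0 : ℝ)..θ, r ^ (2 * H - 2) * g r)) := by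
  have hrate : Tendsto (fun p : ℝ × ℝ => 18 * 2 ^ (β : ℝ) * C * (p.1 + p.2) ^ (β + 2 * H - 1))
      (𝓝[>] 0 ×ˢ 𝓝[>] 0) (𝓝 0) := by
    have h := (tendsto_add_nhdsGT_prod.rpow_const
      (Or.inr (by linarith : 0 ≤ β + 2 * H - 1))).const_mul (18 * 2 ^ (β : ℝ) * C : ℝ)
    rwa [Real.zero_rpow (by linarith), mul_zero] at h
  have hnear : Tendsto
      (fun p : ℝ × ℝ => ∫ r in (0 : ℝ)..2 * (p.1 + p.2), fbmKernel H p.1 p.2 r * g r)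
      (𝓝[>] 0 ×ˢ 𝓝[>] 0) (𝓝 0) := by
    refine squeeze_zero_norm' ?_ hrate
    filter_upwards [eventually_pos_prod] with p ⟨hp, hp'⟩
    exact abs_integral_fbmKernel_mul_le_of_le hH hH' hp hp' hgc hg (by positivity) le_rfl
  refine (zero_add (H * (2 * H - 1) * _) ▸
    hnear.add (tendsto_integral_far_fbmKernel_mul hH hH' hβ hgc hg hθ)).congr fun p => ?_
  have h_int := ((continuous_fbmKernel hH p.1 p.2).mul hgc).intervalIntegrable (μ := volume)
  exact intervalIntegral.integral_add_adjacent_intervals (h_int _ _) (h_int _ _)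

theorem tendsto_integral_integral_fbmKernel_mul {k : ℝ → ℝ → ℝ} (hH : 0 ≤ H) (hH' : H ≤ 1)
    (hβ : 1 - 2 * H < β) (hk : Continuous (Function.uncurry k))
    (hkb : ∀ θ r, 0 ≤ r → |k θ r| ≤ C * r ^ (β : ℝ)) (ht : 0 ≤ t) :
    Tendsto (fun p : ℝ × ℝ => ∫ θ in (0 : ℝ)..t, ∫ r in (0 : ℝ)..θ, fbmKernel H p.1 p.2 r * k θ r)
      (𝓝[>] 0 ×ˢ 𝓝[>] 0)
      (𝓝 (H * (2 * H - 1) * ∫ θ in (0 : ℝ)..t, ∫ r in (0 : ℝ)..θ, r ^ (2 * H - 2) * k θ r)) := by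
  have hkc : ∀ θ, Continuous (k θ) := fun θ => by fun_prop
  rw [← intervalIntegral.integral_const_mul]
  refine intervalIntegral.tendsto_integral_filter_of_dominated_convergence
    (fun _ => 18 * 2 ^ (β : ℝ) * C + ∫ r in (0 : ℝ)..t, 4 * C * r ^ (2 * H - 2 + β))
    (Eventually.of_forall fun p => ?_) ?_ intervalIntegrable_const (ae_of_all _ fun θ hθ => ?_)
  · have hK := continuous_fbmKernel hH p.1 p.2
    exact (continuous_integral_zero_self (k := fun θ r => fbmKernel H p.1 p.2 r * k θ r)
      (by fun_prop)).aestronglyMeasurable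
  · filter_upwards [eventually_pos_prod, eventually_two_mul_add_le zero_lt_two] with p hp hp_le
    refine ae_of_all _ fun θ hθ => ?_
    rw [uIoc_of_le ht] at hθ
    refine (abs_integral_fbmKernel_mul_le hH hH' hβ hp.1 hp.2 (hkc θ) (hkb θ) hθ.1.le
      hθ.2).trans ?_
    refine add_le_add (mul_le_of_le_one_right (by positivity) ?_) le_rfl
    exact Real.rpow_le_one (add_pos hp.1 hp.2).le (by linarith) (by linarith)
  · rw [uIoc_of_le ht] at hθ
    exact tendsto_integral_fbmKernel_mul hH hH' hβ (hkc θ) (hkb θ) hθ.1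

theorem tendsto_integral_integral_fbmKernel_mul_left {f : ℝ → ℝ} (hH : 0 < H) (hH' : H ≤ 1)
    (hf : Continuous f) (ht : 0 ≤ t) :
    Tendsto (fun p : ℝ × ℝ =>
        ∫ θ in (0 : ℝ)..t, (∫ r in (0 : ℝ)..θ, fbmKernel H p.1 p.2 r) * f θ)
      (𝓝[>] 0 ×ˢ 𝓝[>] 0) (𝓝 (H * ∫ θ in (0 : ℝ)..t, θ ^ (2 * H - 1) * f θ)) := by
  rw [← intervalIntegral.integral_const_mul]
  refine intervalIntegral.tendsto_integral_filter_of_dominated_convergence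
    (fun θ => 36 * (θ ^ (2 * H - 1) + 1) * |f θ|) (Eventually.of_forall fun p => ?_) ?_
    ((((intervalIntegral.intervalIntegrable_rpow' (by linarith)).add
      intervalIntegrable_const).const_mul 36).mul_continuousOn hf.abs.continuousOn)
    (ae_of_all _ fun θ hθ => ?_)
  · exact ((intervalIntegral.continuous_primitive
      (continuous_fbmKernel hH.le _ _).intervalIntegrable 0).mul hf).aestronglyMeasurable
  · filter_upwards [eventually_pos_prod, eventually_two_mul_add_le zero_lt_two] with p hp hp_le
    refine ae_of_all _ fun θ hθ => ?_
    rw [uIoc_of_le ht] at hθ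
    rw [Real.norm_eq_abs, abs_mul]
    gcongr
    exact abs_integral_fbmKernel_le hH.le hH' hp.1 hp.2 (by linarith) hθ.1
  · rw [uIoc_of_le ht] at hθ
    rw [← mul_assoc]
    exact (tendsto_integral_fbmKernel hH.le hθ.1).mul_const _

end KernelIntegral

section RegularizedCov

/-- The covariance `∫∫ H (2H - 1) |s - r|^(2H-2) q(s, r) ds dr` over `[0, t]²` of the nonlinear
integrals, for `q s r = Q (φ s) (ψ r)`. The kernel is not integrable near the diagonal when
`H ≤ 1/2`, so the diagonal values of `q` are split off and contribute the first term. -/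
noncomputable def regularizedCov (H t : ℝ) (q : ℝ → ℝ → ℝ) : ℝ :=
  2 * H * (∫ θ in (0 : ℝ)..t, θ ^ (2 * H - 1) * q θ θ)
    + H * (2 * H - 1) * (∫ θ in (0 : ℝ)..t, ∫ r in (0 : ℝ)..θ,
        r ^ (2 * H - 2) * (q θ (θ - r) - q θ θ))
    + H * (2 * H - 1) * (∫ θ in (0 : ℝ)..t, ∫ r in (0 : ℝ)..θ,
        r ^ (2 * H - 2) * (q (θ - r) θ - q θ θ))

variable {H t θ r : ℝ} {A β : ℝ≥0} {q q' : ℝ → ℝ → ℝ} {s : Set ℝ}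

theorem abs_apply_sub_right_sub_le (hq : HolderOnWith A β (Function.uncurry q) (s ×ˢ s))
    (hθ : θ ∈ s) (hθr : θ - r ∈ s) (hr : 0 ≤ r) :
    |q θ (θ - r) - q θ θ| ≤ A * r ^ (β : ℝ) := by
  simpa [Real.dist_eq, Prod.dist_eq, abs_of_nonneg hr, hr] using
    hq.dist_le (mk_mem_prod hθ hθr) (mk_mem_prod hθ hθ)

theorem abs_apply_sub_left_sub_le (hq : HolderOnWith A β (Function.uncurry q) (s ×ˢ s))
    (hθ : θ ∈ s) (hθr : θ - r ∈ s) (hr : 0 ≤ r) :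
    |q (θ - r) θ - q θ θ| ≤ A * r ^ (β : ℝ) := by
  simpa [Real.dist_eq, Prod.dist_eq, abs_of_nonneg hr, hr] using
    hq.dist_le (mk_mem_prod hθr hθ) (mk_mem_prod hθ hθ)

theorem tendsto_regularizedCov_of_holderWith (hH : 0 < H) (hH' : H ≤ 1) (hβ : 1 - 2 * H < β)
    (hβ0 : 0 < β) (hq : HolderWith A β (Function.uncurry q)) (ht : 0 ≤ t) :
    Tendsto (fun p : ℝ × ℝ =>
        ∫ s in (0 : ℝ)..t, ∫ r in (0 : ℝ)..t, fbmKernel H p.1 p.2 (s - r) * q s r)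
      (𝓝[>] 0 ×ˢ 𝓝[>] 0) (𝓝 (regularizedCov H t q)) := by
  have hqc : Continuous (Function.uncurry q) := hq.continuous hβ0
  have hq_univ := hq.holderOnWith (univ ×ˢ univ)
  have hdiag := tendsto_integral_integral_fbmKernel_mul_left (f := fun θ => q θ θ) hH hH'
    (by fun_prop) ht
  have hright := tendsto_integral_integral_fbmKernel_mul (k := fun θ r => q θ (θ - r) - q θ θ)
    hH.le hH' hβ (by fun_prop)
    (fun _ _ => abs_apply_sub_right_sub_le hq_univ (mem_univ _) (mem_univ _)) ht
  have hleft := tendsto_integral_integral_fbmKernel_mul (k := fun θ r => q (θ - r) θ - q θ θ)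
    hH.le hH' hβ (by fun_prop)
    (fun _ _ => abs_apply_sub_left_sub_le hq_univ (mem_univ _) (mem_univ _)) ht
  have hsum := ((hdiag.const_mul 2).add hright).add hleft
  rw [← mul_assoc] at hsum
  exact hsum.congr fun p => (integral_integral_even_sub_mul (even_fbmKernel H p.1 p.2)
    (continuous_fbmKernel hH.le p.1 p.2) hqc ht).symm

theorem exists_holderWith_of_holderOnWith_Icc {a b : ℝ} (hab : a ≤ b)
    (hq : HolderOnWith A β (Function.uncurry q) (Icc a b ×ˢ Icc a b)) :
    ∃ q' : ℝ → ℝ → ℝ, HolderWith A β (Function.uncurry q') ∧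
      ∀ s ∈ Icc a b, ∀ r ∈ Icc a b, q' s r = q s r := by
  refine ⟨fun s r => q (projIcc a b hab s) (projIcc a b hab r), fun p p' => ?_,
    fun s hs r hr => by simp only [projIcc_of_mem hab hs, projIcc_of_mem hab hr]⟩
  have hproj : ∀ x y, edist (projIcc a b hab x : ℝ) (projIcc a b hab y) ≤ edist x y := fun x y => by
    simpa only [ENNReal.coe_one, one_mul, Subtype.edist_eq] using LipschitzWith.projIcc hab x y
  refine (hq.edist_le (mk_mem_prod (projIcc a b hab p.1).2 (projIcc a b hab p.2).2)
    (mk_mem_prod (projIcc a b hab p'.1).2 (projIcc a b hab p'.2).2)).trans ?_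
  gcongr
  exact max_le_max (hproj _ _) (hproj _ _)

theorem regularizedCov_congr (ht : 0 ≤ t)
    (h : ∀ s ∈ Icc 0 t, ∀ r ∈ Icc 0 t, q s r = q' s r) :
    regularizedCov H t q = regularizedCov H t q' := by
  have hsub : ∀ θ ∈ uIcc 0 t, ∀ r ∈ uIcc 0 θ, θ ∈ Icc 0 t ∧ θ - r ∈ Icc 0 t := by
    intro θ hθ r hr
    rw [uIcc_of_le ht] at hθ
    rw [uIcc_of_le hθ.1] at hr
    exact ⟨hθ, by linarith [hr.2], by linarith [hr.1, hθ.2]⟩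
  have hdiag : ∫ θ in (0 : ℝ)..t, θ ^ (2 * H - 1) * q θ θ =
      ∫ θ in (0 : ℝ)..t, θ ^ (2 * H - 1) * q' θ θ :=
    intervalIntegral.integral_congr fun θ hθ => by
      rw [uIcc_of_le ht] at hθ
      simp only [h θ hθ θ hθ]
  have hright : ∫ θ in (0 : ℝ)..t, ∫ r in (0 : ℝ)..θ, r ^ (2 * H - 2) * (q θ (θ - r) - q θ θ) =
      ∫ θ in (0 : ℝ)..t, ∫ r in (0 : ℝ)..θ, r ^ (2 * H - 2) * (q' θ (θ - r) - q' θ θ) :=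
    intervalIntegral.integral_congr fun θ hθ => intervalIntegral.integral_congr fun r hr => by
      obtain ⟨hθ, hθr⟩ := hsub θ hθ r hr
      simp only [h θ hθ θ hθ, h θ hθ _ hθr]
  have hleft : ∫ θ in (0 : ℝ)..t, ∫ r in (0 : ℝ)..θ, r ^ (2 * H - 2) * (q (θ - r) θ - q θ θ) =
      ∫ θ in (0 : ℝ)..t, ∫ r in (0 : ℝ)..θ, r ^ (2 * H - 2) * (q' (θ - r) θ - q' θ θ) :=
    intervalIntegral.integral_congr fun θ hθ => intervalIntegral.integral_congr fun r hr => by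
      obtain ⟨hθ, hθr⟩ := hsub θ hθ r hr
      simp only [h θ hθ θ hθ, h _ hθr θ hθ]
  rw [regularizedCov, hdiag, hright, hleft, regularizedCov]

theorem tendsto_regularizedCov (hH : 0 < H) (hH' : H ≤ 1) (hβ : 1 - 2 * H < β) (hβ0 : 0 < β)
    (hq : HolderOnWith A β (Function.uncurry q) (Icc 0 t ×ˢ Icc 0 t)) (ht : 0 ≤ t) :
    Tendsto (fun p : ℝ × ℝ =>
        ∫ s in (0 : ℝ)..t, ∫ r in (0 : ℝ)..t, fbmKernel H p.1 p.2 (s - r) * q s r)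
      (𝓝[>] 0 ×ˢ 𝓝[>] 0) (𝓝 (regularizedCov H t q)) := by
  obtain ⟨q', hq', heq⟩ := exists_holderWith_of_holderOnWith_Icc ht hq
  rw [← regularizedCov_congr ht heq]
  refine (tendsto_regularizedCov_of_holderWith hH hH' hβ hβ0 hq' ht).congr fun p => ?_
  refine intervalIntegral.integral_congr fun s hs => intervalIntegral.integral_congr fun r hr => ?_
  rw [uIcc_of_le ht] at hs hr
  simp only [heq s hs r hr]

theorem intervalIntegrable_rpow_mul_diag (hH : 0 < H) (hβ0 : 0 < β)
    (hq : HolderOnWith A β (Function.uncurry q) (Icc 0 t ×ˢ Icc 0 t)) (ht : 0 ≤ t) :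
    IntervalIntegrable (fun θ => θ ^ (2 * H - 1) * q θ θ) volume 0 t := by
  refine (intervalIntegral.intervalIntegrable_rpow' (by linarith)).mul_continuousOn ?_
  rw [uIcc_of_le ht]
  exact (hq.continuousOn hβ0).comp (f := fun θ => (θ, θ)) (by fun_prop) fun θ hθ => ⟨hθ, hθ⟩

theorem measurableSet_triangle (t : ℝ) : MeasurableSet (triangle t) :=
  (measurableSet_lt measurable_const measurable_snd).inter
    ((measurableSet_le measurable_snd measurable_fst).inter
      (measurableSet_le measurable_fst measurable_const))

theorem mem_Icc_of_mem_triangle {p : ℝ × ℝ} (hp : p ∈ triangle t) :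
    p.1 ∈ Icc 0 t ∧ p.1 - p.2 ∈ Icc 0 t :=
  ⟨⟨hp.1.le.trans hp.2.1, hp.2.2⟩, by linarith [hp.2.1], by linarith [hp.1, hp.2.2]⟩

theorem integrableOn_triangle_rpow_mul {k : ℝ × ℝ → ℝ} (hβ : 1 - 2 * H < β)
    (hk : ContinuousOn k (triangle t)) (hkb : ∀ p ∈ triangle t, |k p| ≤ A * p.2 ^ (β : ℝ)) :
    IntegrableOn (fun p : ℝ × ℝ => p.2 ^ (2 * H - 2) * k p) (triangle t) := by
  have hsub : triangle t ⊆ Ioc 0 t ×ˢ Ioc 0 t := fun p hp =>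
    ⟨⟨hp.1.trans_le hp.2.1, hp.2.2⟩, hp.1, hp.2.1.trans hp.2.2⟩
  have hdom : IntegrableOn (fun p : ℝ × ℝ => A * p.2 ^ (2 * H - 2 + β)) (triangle t) := by
    refine IntegrableOn.mono_set ?_ hsub
    rw [IntegrableOn, Measure.volume_eq_prod, ← Measure.prod_restrict]
    exact Integrable.comp_snd ((intervalIntegral.intervalIntegrable_rpow'
      (a := 0) (b := t) (by linarith)).1.const_mul (A : ℝ)) _
  refine hdom.mono' ?_ ?_
  · exact (measurable_snd.pow_const _).aestronglyMeasurable.mul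
      (hk.aestronglyMeasurable (measurableSet_triangle t))
  · refine (ae_restrict_iff' (measurableSet_triangle t)).2 (ae_of_all _ fun p hp => ?_)
    have hp0 : 0 < p.2 := hp.1
    calc ‖p.2 ^ (2 * H - 2) * k p‖ = p.2 ^ (2 * H - 2) * |k p| := by
          rw [norm_mul, Real.norm_of_nonneg (by positivity), Real.norm_eq_abs]
      _ ≤ p.2 ^ (2 * H - 2) * (A * p.2 ^ (β : ℝ)) := by
          gcongr
          exact hkb p hp
      _ = A * p.2 ^ (2 * H - 2 + β) := by
          rw [Real.rpow_add hp0]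
          ring

theorem integrableOn_triangle_rpow_mul_right (hβ : 1 - 2 * H < β) (hβ0 : 0 < β)
    (hq : HolderOnWith A β (Function.uncurry q) (Icc 0 t ×ˢ Icc 0 t)) :
    IntegrableOn (fun p : ℝ × ℝ => p.2 ^ (2 * H - 2) * (q p.1 (p.1 - p.2) - q p.1 p.1))
      (triangle t) :=
  integrableOn_triangle_rpow_mul hβ
    (((hq.continuousOn hβ0).comp (f := fun p : ℝ × ℝ => (p.1, p.1 - p.2)) (by fun_prop)
        fun _ hp => mem_Icc_of_mem_triangle hp).sub
      ((hq.continuousOn hβ0).comp (f := fun p : ℝ × ℝ => (p.1, p.1)) (by fun_prop)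
        fun _ hp => ⟨(mem_Icc_of_mem_triangle hp).1, (mem_Icc_of_mem_triangle hp).1⟩))
    fun _ hp => abs_apply_sub_right_sub_le hq (mem_Icc_of_mem_triangle hp).1
      (mem_Icc_of_mem_triangle hp).2 hp.1.le

theorem integrableOn_triangle_rpow_mul_left (hβ : 1 - 2 * H < β) (hβ0 : 0 < β)
    (hq : HolderOnWith A β (Function.uncurry q) (Icc 0 t ×ˢ Icc 0 t)) :
    IntegrableOn (fun p : ℝ × ℝ => p.2 ^ (2 * H - 2) * (q (p.1 - p.2) p.1 - q p.1 p.1))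
      (triangle t) :=
  integrableOn_triangle_rpow_mul hβ
    (((hq.continuousOn hβ0).comp (f := fun p : ℝ × ℝ => (p.1 - p.2, p.1)) (by fun_prop)
        fun _ hp => (mem_Icc_of_mem_triangle hp).symm).sub
      ((hq.continuousOn hβ0).comp (f := fun p : ℝ × ℝ => (p.1, p.1)) (by fun_prop)
        fun _ hp => ⟨(mem_Icc_of_mem_triangle hp).1, (mem_Icc_of_mem_triangle hp).1⟩))
    fun _ hp => abs_apply_sub_left_sub_le hq (mem_Icc_of_mem_triangle hp).1
      (mem_Icc_of_mem_triangle hp).2 hp.1.le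

end RegularizedCov

section SecondOrder

theorem exists_tendsto_of_tendsto_inner {ι 𝕜 E : Type*} [RCLike 𝕜] [NormedAddCommGroup E]
    [InnerProductSpace 𝕜 E] [CompleteSpace E] {l : Filter ι} [l.NeBot] {F : ι → E} {c : 𝕜}
    (h : Tendsto (fun p : ι × ι => inner 𝕜 (F p.1) (F p.2)) (l ×ˢ l) (𝓝 c)) :
    ∃ x, Tendsto F l (𝓝 x) := by
  have hre : Tendsto (fun p : ι × ι => RCLike.re (inner 𝕜 (F p.1) (F p.2))) (l ×ˢ l)
      (𝓝 (RCLike.re c)) := (RCLike.continuous_re.tendsto c).comp h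
  have hsq : Tendsto (fun p : ι × ι => dist (F p.1) (F p.2) ^ 2) (l ×ˢ l) (𝓝 0) := by
    have hfst := hre.comp (tendsto_fst.prodMk tendsto_fst : Tendsto _ (l ×ˢ l) _)
    have hsnd := hre.comp (tendsto_snd.prodMk tendsto_snd : Tendsto _ (l ×ˢ l) _)
    have hexpand := (hfst.sub (hre.const_mul 2)).add hsnd
    rw [show RCLike.re c - 2 * RCLike.re c + RCLike.re c = 0 by ring] at hexpand
    refine hexpand.congr fun p => ?_
    simp only [dist_eq_norm, norm_sub_sq (𝕜 := 𝕜), Function.comp_apply, inner_self_eq_norm_sq]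
  have hdist : Tendsto (fun p : ι × ι => dist (F p.1) (F p.2)) (l ×ˢ l) (𝓝 0) := by
    simpa only [Real.sqrt_zero, Real.sqrt_sq dist_nonneg] using hsq.sqrt
  exact CompleteSpace.complete
    (cauchy_map_iff.2 ⟨inferInstance, tendsto_uniformity_iff_dist_tendsto_zero.2 hdist⟩)

variable {Ω ι : Type*} [MeasurableSpace Ω] {P : Measure Ω} {l : Filter ι}

theorem inner_toLp {X Y : Ω → ℝ} (hX : MemLp X 2 P) (hY : MemLp Y 2 P) :
    inner ℝ (hX.toLp X) (hY.toLp Y) = ∫ ω, X ω * Y ω ∂P := by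
  rw [L2.inner_def]
  refine integral_congr_ae ?_
  filter_upwards [hX.coeFn_toLp, hY.coeFn_toLp] with ω hXω hYω
  rw [hXω, hYω, real_inner_comm]
  rfl

theorem exists_tendsto_eLpNorm_sub_of_tendsto_integral_mul [l.NeBot] {X : ι → Ω → ℝ}
    (hX : ∀ i, MemLp (X i) 2 P) {c : ℝ}
    (h : Tendsto (fun p : ι × ι => ∫ ω, X p.1 ω * X p.2 ω ∂P) (l ×ˢ l) (𝓝 c)) :
    ∃ I, MemLp I 2 P ∧ Tendsto (fun i => eLpNorm (fun ω => X i ω - I ω) 2 P) l (𝓝 0) := by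
  obtain ⟨I, hI⟩ := exists_tendsto_of_tendsto_inner (𝕜 := ℝ) (F := fun i => (hX i).toLp (X i))
    (by simpa only [inner_toLp] using h)
  exact ⟨I, Lp.memLp I, (Lp.tendsto_Lp_iff_tendsto_eLpNorm'' X hX I (Lp.memLp I)).1
    (by rwa [Lp.toLp_coeFn])⟩

theorem tendsto_integral_mul_of_tendsto_eLpNorm_sub {X Y : ι → Ω → ℝ} {I J : Ω → ℝ}
    (hX : ∀ i, MemLp (X i) 2 P) (hY : ∀ i, MemLp (Y i) 2 P) (hI : MemLp I 2 P) (hJ : MemLp J 2 P)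
    (hXI : Tendsto (fun i => eLpNorm (fun ω => X i ω - I ω) 2 P) l (𝓝 0))
    (hYJ : Tendsto (fun i => eLpNorm (fun ω => Y i ω - J ω) 2 P) l (𝓝 0)) :
    Tendsto (fun i => ∫ ω, X i ω * Y i ω ∂P) l (𝓝 (∫ ω, I ω * J ω ∂P)) := by
  simpa only [inner_toLp] using ((Lp.tendsto_Lp_iff_tendsto_eLpNorm'' X hX I hI).2 hXI).inner
    (𝕜 := ℝ) ((Lp.tendsto_Lp_iff_tendsto_eLpNorm'' Y hY J hJ).2 hYJ)

variable {S T : Type*} [MeasurableSpace S] [MeasurableSpace T] {μ : Measure S} {ν : Measure T}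
  [IsFiniteMeasure μ] [IsFiniteMeasure ν] [SFinite P] {Y : S → Ω → ℝ} {Z : T → Ω → ℝ}

theorem integrable_mul_of_memLp_prod (hY : MemLp (Function.uncurry Y) 2 (μ.prod P))
    (hZ : MemLp (Function.uncurry Z) 2 (ν.prod P)) :
    Integrable (fun p : (S × T) × Ω => Y p.1.1 p.2 * Z p.1.2 p.2) ((μ.prod ν).prod P) := by
  have hY' : MemLp (fun p : (S × T) × Ω => Y p.1.1 p.2) 2 ((μ.prod ν).prod P) :=
    ((hY.comp_snd ν).comp_measurePreserving (measurePreserving_prodAssoc ν μ P)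
      ).comp_measurePreserving (Measure.measurePreserving_swap.prod (MeasurePreserving.id P))
  have hZ' : MemLp (fun p : (S × T) × Ω => Z p.1.2 p.2) 2 ((μ.prod ν).prod P) :=
    (hZ.comp_snd μ).comp_measurePreserving (measurePreserving_prodAssoc μ ν P)
  exact hY'.integrable_mul hZ'

theorem integral_integral_mul_integral (hY : MemLp (Function.uncurry Y) 2 (μ.prod P))
    (hZ : MemLp (Function.uncurry Z) 2 (ν.prod P)) :
    ∫ ω, (∫ s, Y s ω ∂μ) * (∫ r, Z r ω ∂ν) ∂P = ∫ s, ∫ r, ∫ ω, Y s ω * Z r ω ∂P ∂ν ∂μ := by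
  have hYZ := integrable_mul_of_memLp_prod hY hZ
  calc ∫ ω, (∫ s, Y s ω ∂μ) * (∫ r, Z r ω ∂ν) ∂P
      = ∫ ω, ∫ p, Y p.1 ω * Z p.2 ω ∂(μ.prod ν) ∂P := by
        simp only [fun ω => integral_prod_mul (μ := μ) (ν := ν) (fun s => Y s ω) fun r => Z r ω]
    _ = ∫ p, ∫ ω, Y p.1 ω * Z p.2 ω ∂P ∂(μ.prod ν) :=
        integral_integral_swap (f := fun ω (p : S × T) => Y p.1 ω * Z p.2 ω) hYZ.swap
    _ = ∫ s, ∫ r, ∫ ω, Y s ω * Z r ω ∂P ∂ν ∂μ := integral_prod _ hYZ.integral_prod_left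

theorem memLp_two_integral (hY : MemLp (Function.uncurry Y) 2 (μ.prod P)) :
    MemLp (fun ω => ∫ s, Y s ω ∂μ) 2 P := by
  refine (memLp_two_iff_integrable_sq hY.1.prod_swap.integral_prod_right').2 ?_
  refine (integrable_mul_of_memLp_prod hY hY).integral_prod_right.congr (ae_of_all _ fun ω => ?_)
  exact (integral_prod_mul (fun s => Y s ω) fun s => Y s ω).trans (sq _).symm

end SecondOrder

section Field

/-- `W` is a jointly measurable second-order random field whose second moments are those of
an `IsFractionalField`: the part of that structure visible to the geometry of `L²(Ω)`. -/
structure IsSecondOrderField {Ω : Type*} [MeasurableSpace Ω] {d : ℕ} (P : Measure Ω)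
    (W : ℝ → EuclideanSpace ℝ (Fin d) → Ω → ℝ) (H : ℝ)
    (Q : EuclideanSpace ℝ (Fin d) → EuclideanSpace ℝ (Fin d) → ℝ) : Prop where
  measurable : Measurable
    (fun p : (ℝ × EuclideanSpace ℝ (Fin d)) × Ω => W p.1.1 p.1.2 p.2)
  memLp_two : ∀ t x, MemLp (W t x) 2 P
  integral_mul : ∀ t x s y, ∫ ω, W t x ω * W s y ω ∂P = fbmCov H t s * Q x y

variable {Ω : Type*} [MeasurableSpace Ω] {P : Measure Ω} {d : ℕ} {H : ℝ}
  {Q : EuclideanSpace ℝ (Fin d) → EuclideanSpace ℝ (Fin d) → ℝ}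
  {W : ℝ → EuclideanSpace ℝ (Fin d) → Ω → ℝ}

theorem IsFractionalField.isSecondOrderField (hW : IsFractionalField P W H Q) :
    IsSecondOrderField P W H Q where
  measurable := hW.measurable
  memLp_two t x := (hW.gaussian.hasGaussianLaw_eval (t, x)).memLp_two
  integral_mul := hW.covariance

namespace IsSecondOrderField

theorem memLp_Wdot (hW : IsSecondOrderField P W H Q) (ε s : ℝ)
    (x : EuclideanSpace ℝ (Fin d)) : MemLp (Wdot W ε s x) 2 P :=
  ((hW.memLp_two _ x).sub (hW.memLp_two _ x)).const_mul _

theorem integral_Wdot_mul_Wdot (hW : IsSecondOrderField P W H Q) (ε ε' s r : ℝ)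
    (x y : EuclideanSpace ℝ (Fin d)) :
    ∫ ω, Wdot W ε s x ω * Wdot W ε' r y ω ∂P = fbmKernel H ε ε' (s - r) * Q x y := by
  have h_int : ∀ a b, Integrable (fun ω => W a x ω * W b y ω) P := fun a b =>
    (hW.memLp_two a x).integrable_mul (hW.memLp_two b y)
  have hint_sub : ∀ a b c, Integrable (fun ω => W a x ω * W b y ω - W a x ω * W c y ω) P :=
    fun a b c => (h_int a b).sub (h_int a c)
  have hexpand : ∀ ω, Wdot W ε s x ω * Wdot W ε' r y ω = (1 / (2 * ε) * (1 / (2 * ε'))) *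
      ((W (s + ε) x ω * W (r + ε') y ω - W (s + ε) x ω * W (r - ε') y ω) -
        (W (s - ε) x ω * W (r + ε') y ω - W (s - ε) x ω * W (r - ε') y ω)) := fun ω => by
    unfold Wdot
    ring
  simp only [hexpand]
  rw [integral_const_mul, integral_sub (hint_sub _ _ _) (hint_sub _ _ _),
    integral_sub (h_int _ _) (h_int _ _), integral_sub (h_int _ _) (h_int _ _)]
  simp only [hW.integral_mul]
  rw [fbmKernel, mixedDiffQuot, fbmCov, fbmCov, fbmCov, fbmCov,
    show s + ε - (r + ε') = s - r + (ε - ε') by ring,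
    show s + ε - (r - ε') = s - r + (ε + ε') by ring,
    show s - ε - (r + ε') = s - r - (ε + ε') by ring,
    show s - ε - (r - ε') = s - r - (ε - ε') by ring]
  ring

variable {φ ψ : ℝ → EuclideanSpace ℝ (Fin d)} {μ : Measure ℝ} {t : ℝ}

theorem aestronglyMeasurable_Wdot_comp [SFinite P] (hW : IsSecondOrderField P W H Q)
    (hφ : AEMeasurable φ μ) (ε : ℝ) :
    AEStronglyMeasurable (Function.uncurry fun s ω => Wdot W ε s (φ s) ω) (μ.prod P) := by
  have hshift : ∀ c : ℝ, AEMeasurable (fun p : ℝ × Ω => W (p.1 + c) (φ p.1) p.2) (μ.prod P) :=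
    fun c => hW.measurable.comp_aemeasurable
      (((measurable_fst.add_const c).aemeasurable.prodMk hφ.comp_fst).prodMk
        measurable_snd.aemeasurable)
  have hdiff := (hshift ε).sub (hshift (-ε))
  simp only [← sub_eq_add_neg] at hdiff
  exact (hdiff.const_mul (1 / (2 * ε))).aestronglyMeasurable

theorem memLp_Wdot_comp [SFinite μ] [SFinite P] (hW : IsSecondOrderField P W H Q)
    (hφ : AEMeasurable φ μ) (hQφ : Integrable (fun s => Q (φ s) (φ s)) μ) (ε : ℝ) :
    MemLp (Function.uncurry fun s ω => Wdot W ε s (φ s) ω) 2 (μ.prod P) := by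
  have hmeas := hW.aestronglyMeasurable_Wdot_comp hφ ε
  rw [memLp_two_iff_integrable_sq hmeas]
  refine (integrable_prod_iff (hmeas.pow 2)).2
    ⟨ae_of_all _ fun s => (hW.memLp_Wdot ε s (φ s)).integrable_sq, ?_⟩
  refine (hQφ.const_mul (fbmKernel H ε ε 0)).congr (ae_of_all _ fun s => ?_)
  simp only [Pi.pow_apply, Function.uncurry_apply_pair, Real.norm_eq_abs, sq,
    abs_mul_self]
  rw [← sub_self s, ← hW.integral_Wdot_mul_Wdot]

theorem memLp_approxIntegral [SFinite P] (hW : IsSecondOrderField P W H Q)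
    (hφ : AEMeasurable φ (volume.restrict (Ioc 0 t)))
    (hQφ : IntegrableOn (fun s => Q (φ s) (φ s)) (Ioc 0 t)) (ht : 0 ≤ t) (ε : ℝ) :
    MemLp (approxIntegral W φ t ε) 2 P := by
  have heq : approxIntegral W φ t ε = fun ω => ∫ s in Ioc 0 t, Wdot W ε s (φ s) ω :=
    funext fun _ => intervalIntegral.integral_of_le ht
  rw [heq]
  exact memLp_two_integral (hW.memLp_Wdot_comp hφ hQφ ε)

theorem integral_approxIntegral_mul [SFinite P] (hW : IsSecondOrderField P W H Q)
    (hφ : AEMeasurable φ (volume.restrict (Ioc 0 t)))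
    (hQφ : IntegrableOn (fun s => Q (φ s) (φ s)) (Ioc 0 t))
    (hψ : AEMeasurable ψ (volume.restrict (Ioc 0 t)))
    (hQψ : IntegrableOn (fun s => Q (ψ s) (ψ s)) (Ioc 0 t)) (ht : 0 ≤ t) (ε ε' : ℝ) :
    ∫ ω, approxIntegral W φ t ε ω * approxIntegral W ψ t ε' ω ∂P =
      ∫ s in (0 : ℝ)..t, ∫ r in (0 : ℝ)..t, fbmKernel H ε ε' (s - r) * Q (φ s) (ψ r) := by
  simp only [approxIntegral, intervalIntegral.integral_of_le ht, ← hW.integral_Wdot_mul_Wdot]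
  exact integral_integral_mul_integral (hW.memLp_Wdot_comp hφ hQφ ε)
    (hW.memLp_Wdot_comp hψ hQψ ε')

theorem exists_isNonlinearIntegral [SFinite P] (hW : IsSecondOrderField P W H Q)
    (hφ : AEMeasurable φ (volume.restrict (Ioc 0 t)))
    (hQφ : IntegrableOn (fun s => Q (φ s) (φ s)) (Ioc 0 t)) (ht : 0 ≤ t) {c : ℝ}
    (hlim : Tendsto (fun p : ℝ × ℝ => ∫ s in (0 : ℝ)..t, ∫ r in (0 : ℝ)..t,
      fbmKernel H p.1 p.2 (s - r) * Q (φ s) (φ r)) (𝓝[>] 0 ×ˢ 𝓝[>] 0) (𝓝 c)) :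
    ∃ I, IsNonlinearIntegral P W φ t I := by
  have hmem := hW.memLp_approxIntegral hφ hQφ ht
  simp only [← hW.integral_approxIntegral_mul hφ hQφ hφ hQφ ht] at hlim
  obtain ⟨I, hI, hI_lim⟩ := exists_tendsto_eLpNorm_sub_of_tendsto_integral_mul hmem hlim
  exact ⟨I, hI, fun ε _ => hmem ε, hI_lim⟩

theorem integral_mul_eq [SFinite P] (hW : IsSecondOrderField P W H Q)
    (hφ : AEMeasurable φ (volume.restrict (Ioc 0 t)))
    (hQφ : IntegrableOn (fun s => Q (φ s) (φ s)) (Ioc 0 t))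
    (hψ : AEMeasurable ψ (volume.restrict (Ioc 0 t)))
    (hQψ : IntegrableOn (fun s => Q (ψ s) (ψ s)) (Ioc 0 t)) (ht : 0 ≤ t) {c : ℝ}
    (hlim : Tendsto (fun p : ℝ × ℝ => ∫ s in (0 : ℝ)..t, ∫ r in (0 : ℝ)..t,
      fbmKernel H p.1 p.2 (s - r) * Q (φ s) (ψ r)) (𝓝[>] 0 ×ˢ 𝓝[>] 0) (𝓝 c))
    {I J : Ω → ℝ} (hI : IsNonlinearIntegral P W φ t I) (hJ : IsNonlinearIntegral P W ψ t J) :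
    ∫ ω, I ω * J ω ∂P = c := by
  simp only [← hW.integral_approxIntegral_mul hφ hQφ hψ hQψ ht] at hlim
  exact tendsto_nhds_unique
    (tendsto_integral_mul_of_tendsto_eLpNorm_sub (hW.memLp_approxIntegral hφ hQφ ht)
      (hW.memLp_approxIntegral hψ hQψ ht) hI.1 hJ.1 hI.2.2 hJ.2.2)
    (hlim.comp (f := fun ε => (ε, ε)) (tendsto_id.prodMk tendsto_id))

end IsSecondOrderField

end Field

section Paths

variable {d : ℕ} {φ ψ : ℝ → EuclideanSpace ℝ (Fin d)} {M K T t : ℝ} {α γ : ℝ≥0}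
  {Q : EuclideanSpace ℝ (Fin d) → EuclideanSpace ℝ (Fin d) → ℝ}

theorem holderOnWith_of_dist_le {X Y : Type*} [PseudoMetricSpace X] [PseudoMetricSpace Y]
    {f : X → Y} {s : Set X} {C r : ℝ≥0}
    (h : ∀ x ∈ s, ∀ y ∈ s, dist (f x) (f y) ≤ C * dist x y ^ (r : ℝ)) : HolderOnWith C r f s := by
  intro x hx y hy
  rw [edist_nndist, edist_nndist, ← ENNReal.coe_rpow_of_nonneg _ r.coe_nonneg, ← ENNReal.coe_mul,
    ENNReal.coe_le_coe, ← NNReal.coe_le_coe]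
  exact_mod_cast h x hx y hy

theorem LocallyHolderCov.exists_holderOnWith (hQ : LocallyHolderCov M γ Q) (hK : 0 < K) :
    ∃ C, HolderOnWith C γ (Function.uncurry Q)
      (Metric.closedBall 0 K ×ˢ Metric.closedBall 0 K) := by
  obtain ⟨C₁, hC₁, hbound⟩ := hQ
  refine ⟨(2 * (C₁ * (1 + K) ^ M)).toNNReal, holderOnWith_of_dist_le fun p hp p' hp' => ?_⟩
  simp only [mem_prod, mem_closedBall_zero_iff] at hp hp'
  rw [Real.coe_toNNReal _ (by positivity)]
  calc dist (Function.uncurry Q p) (Function.uncurry Q p')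
      ≤ C₁ * (1 + K) ^ M * (dist p.1 p'.1 ^ (γ : ℝ) + dist p.2 p'.2 ^ (γ : ℝ)) := by
        simpa only [dist_eq_norm, Real.norm_eq_abs, Function.uncurry_def] using
          hbound K hK p.1 p.2 p'.1 p'.2 hp.1 hp.2 hp'.1 hp'.2
    _ ≤ C₁ * (1 + K) ^ M * (dist p p' ^ (γ : ℝ) + dist p p' ^ (γ : ℝ)) := by
        gcongr
        · exact le_max_left _ _
        · exact le_max_right _ _
    _ = 2 * (C₁ * (1 + K) ^ M) * dist p p' ^ (γ : ℝ) := by ring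

theorem holderOnWith_prodMap {X Y X' Y' : Type*} [PseudoEMetricSpace X] [PseudoEMetricSpace Y]
    [PseudoEMetricSpace X'] [PseudoEMetricSpace Y'] {f : X → Y} {g : X' → Y'} {s : Set X}
    {s' : Set X'} {C D r : ℝ≥0} (hf : HolderOnWith C r f s) (hg : HolderOnWith D r g s') :
    HolderOnWith (max C D) r (Prod.map f g) (s ×ˢ s') := fun p hp p' hp' => by
  refine max_le ((hf.edist_le hp.1 hp'.1).trans ?_) ((hg.edist_le hp.2 hp'.2).trans ?_)
  · gcongr
    · exact le_max_left _ _
    · exact le_max_left _ _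
  · gcongr
    · exact le_max_right _ _
    · exact le_max_right _ _

theorem IsHolderPath.continuousOn (hφ : IsHolderPath α T φ) (hα : 0 < α) (htT : t ≤ T) :
    ContinuousOn φ (Icc 0 t) := by
  obtain ⟨C, hC⟩ := hφ
  exact (hC.continuousOn hα).mono (Icc_subset_Icc_right htT)

theorem IsHolderPath.aemeasurable (hφ : IsHolderPath α T φ) (hα : 0 < α) (htT : t ≤ T) :
    AEMeasurable φ (volume.restrict (Ioc 0 t)) :=
  ((hφ.continuousOn hα htT).mono Ioc_subset_Icc_self).aemeasurable measurableSet_Ioc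

theorem LocallyHolderCov.exists_holderOnWith_comp (hQ : LocallyHolderCov M γ Q) (hα : 0 < α)
    (hφ : IsHolderPath α T φ) (hψ : IsHolderPath α T ψ) (htT : t ≤ T) :
    ∃ A, HolderOnWith A (γ * α) (Function.uncurry fun s r => Q (φ s) (ψ r))
      (Icc 0 t ×ˢ Icc 0 t) := by
  obtain ⟨K, hK⟩ := isCompact_Icc.exists_bound_of_continuousOn (hφ.continuousOn hα htT)
  obtain ⟨L, hL⟩ := isCompact_Icc.exists_bound_of_continuousOn (hψ.continuousOn hα htT)
  obtain ⟨C, hC⟩ := hQ.exists_holderOnWith (lt_max_of_lt_right one_pos : 0 < max (max K L) 1)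
  obtain ⟨Cφ, hCφ⟩ := hφ
  obtain ⟨Cψ, hCψ⟩ := hψ
  refine ⟨_, hC.comp (holderOnWith_prodMap (hCφ.mono (Icc_subset_Icc_right htT))
    (hCψ.mono (Icc_subset_Icc_right htT))) fun p hp => ?_⟩
  simp only [mem_prod, mem_closedBall_zero_iff, Prod.map_fst, Prod.map_snd]
  exact ⟨le_max_of_le_left (le_max_of_le_left (hK _ hp.1)),
    le_max_of_le_left (le_max_of_le_right (hL _ hp.2))⟩

theorem integrableOn_diag_of_holderOnWith {q : ℝ → ℝ → ℝ} {A β : ℝ≥0} (hβ0 : 0 < β)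
    (hq : HolderOnWith A β (Function.uncurry q) (Icc 0 t ×ˢ Icc 0 t)) :
    IntegrableOn (fun s => q s s) (Ioc 0 t) :=
  (((hq.continuousOn hβ0).comp (f := fun s => (s, s)) (by fun_prop)
    fun _ hs => ⟨hs, hs⟩).integrableOn_compact isCompact_Icc).mono_set Ioc_subset_Icc_self

end Paths

end NonlinearFBM

theorem mainTheorem7_general {Ω : Type*} [MeasurableSpace Ω] (P : Measure Ω) [SFinite P]
    (d : ℕ) (H M γ : ℝ) (hH : 0 < H) (hH' : H ≤ 1) (hγ : 0 < γ)
    (Q : EuclideanSpace ℝ (Fin d) → EuclideanSpace ℝ (Fin d) → ℝ)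
    (hQ : NonlinearFBM.LocallyHolderCov M γ Q)
    (W : ℝ → EuclideanSpace ℝ (Fin d) → Ω → ℝ)
    (hW : NonlinearFBM.IsSecondOrderField P W H Q)
    (T t : ℝ) (ht : 0 ≤ t) (htT : t ≤ T)
    (α : ℝ≥0) (hα0 : 0 < α) (hα : 1 - 2 * H < (α : ℝ) * γ)
    (φ ψ : ℝ → EuclideanSpace ℝ (Fin d))
    (hφ : NonlinearFBM.IsHolderPath α T φ) (hψ : NonlinearFBM.IsHolderPath α T ψ) :
    (∃ I : Ω → ℝ, NonlinearFBM.IsNonlinearIntegral P W φ t I) ∧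
    (∃ J : Ω → ℝ, NonlinearFBM.IsNonlinearIntegral P W ψ t J) ∧
    IntervalIntegrable (fun θ : ℝ => θ ^ (2 * H - 1) * Q (φ θ) (ψ θ)) volume 0 t ∧
    IntegrableOn (fun p : ℝ × ℝ => p.2 ^ (2 * H - 2) *
      (Q (φ p.1) (ψ (p.1 - p.2)) - Q (φ p.1) (ψ p.1))) (NonlinearFBM.triangle t) volume ∧
    IntegrableOn (fun p : ℝ × ℝ => p.2 ^ (2 * H - 2) *
      (Q (φ (p.1 - p.2)) (ψ p.1) - Q (φ p.1) (ψ p.1))) (NonlinearFBM.triangle t) volume ∧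
    ∀ I J : Ω → ℝ, NonlinearFBM.IsNonlinearIntegral P W φ t I →
      NonlinearFBM.IsNonlinearIntegral P W ψ t J →
      Integrable (fun ω => I ω * J ω) P ∧
      ∫ ω, I ω * J ω ∂P = NonlinearFBM.regularizedCov H t fun s r => Q (φ s) (ψ r) := by
  open NonlinearFBM in
  lift γ to ℝ≥0 using hγ.le
  have hβ0 : 0 < γ * α := mul_pos hγ hα0
  have hβ : 1 - 2 * H < ↑(γ * α) := by rwa [NNReal.coe_mul, mul_comm (γ : ℝ)]
  obtain ⟨_, hq⟩ := hQ.exists_holderOnWith_comp hα0 hφ hψ htT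
  obtain ⟨_, hqφ⟩ := hQ.exists_holderOnWith_comp hα0 hφ hφ htT
  obtain ⟨_, hqψ⟩ := hQ.exists_holderOnWith_comp hα0 hψ hψ htT
  have hφm := hφ.aemeasurable hα0 htT
  have hψm := hψ.aemeasurable hα0 htT
  have hQφ := integrableOn_diag_of_holderOnWith hβ0 hqφ
  have hQψ := integrableOn_diag_of_holderOnWith hβ0 hqψ
  exact ⟨hW.exists_isNonlinearIntegral hφm hQφ ht (tendsto_regularizedCov hH hH' hβ hβ0 hqφ ht),
    hW.exists_isNonlinearIntegral hψm hQψ ht (tendsto_regularizedCov hH hH' hβ hβ0 hqψ ht),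
    intervalIntegrable_rpow_mul_diag hH hβ0 hq ht, integrableOn_triangle_rpow_mul_right hβ hβ0 hq,
    integrableOn_triangle_rpow_mul_left hβ hβ0 hq, fun I J hI hJ => ⟨hI.1.integrable_mul hJ.1,
      hW.integral_mul_eq hφm hQφ hψm hQψ ht (tendsto_regularizedCov hH hH' hβ hβ0 hq ht) hI hJ⟩⟩

theorem mainTheorem7 {Ω : Type*} [MeasurableSpace Ω] (P : Measure Ω) [IsProbabilityMeasure P]
    (d : ℕ) (H M γ : ℝ) (hH : 0 < H) (hH' : H < 1 / 2) (hM : M < 2) (hγ : 0 < γ) (hγ' : γ ≤ 1)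
    (Q : EuclideanSpace ℝ (Fin d) → EuclideanSpace ℝ (Fin d) → ℝ)
    (hQ1 : NonlinearFBM.LocallyBoundedCov M Q) (hQ2 : NonlinearFBM.LocallyHolderCov M γ Q)
    (W : ℝ → EuclideanSpace ℝ (Fin d) → Ω → ℝ)
    (hW : NonlinearFBM.IsFractionalField P W H Q)
    (T t : ℝ) (ht : 0 ≤ t) (htT : t ≤ T)
    (α : ℝ≥0) (hα : 1 - 2 * H < (α : ℝ) * γ)
    (φ ψ : ℝ → EuclideanSpace ℝ (Fin d))
    (hφ : NonlinearFBM.IsHolderPath α T φ) (hψ : NonlinearFBM.IsHolderPath α T ψ) :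
    -- both stochastic integrals exist
    (∃ I : Ω → ℝ, NonlinearFBM.IsNonlinearIntegral P W φ t I) ∧
    (∃ J : Ω → ℝ, NonlinearFBM.IsNonlinearIntegral P W ψ t J) ∧
    -- the three deterministic integrals converge absolutely
    IntervalIntegrable (fun θ : ℝ => θ ^ (2 * H - 1) * Q (φ θ) (ψ θ)) volume 0 t ∧
    IntegrableOn (fun p : ℝ × ℝ => p.2 ^ (2 * H - 2) *
      (Q (φ p.1) (ψ (p.1 - p.2)) - Q (φ p.1) (ψ p.1))) (NonlinearFBM.triangle t) volume ∧
    IntegrableOn (fun p : ℝ × ℝ => p.2 ^ (2 * H - 2) *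
      (Q (φ (p.1 - p.2)) (ψ p.1) - Q (φ p.1) (ψ p.1))) (NonlinearFBM.triangle t) volume ∧
    -- the covariance formula
    ∀ I J : Ω → ℝ, NonlinearFBM.IsNonlinearIntegral P W φ t I →
      NonlinearFBM.IsNonlinearIntegral P W ψ t J →
      Integrable (fun ω => I ω * J ω) P ∧
      ∫ ω, I ω * J ω ∂P =
        2 * H * (∫ θ in (0 : ℝ)..t, θ ^ (2 * H - 1) * Q (φ θ) (ψ θ))
        + H * (2 * H - 1) * (∫ θ in (0 : ℝ)..t, ∫ r in (0 : ℝ)..θ,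
            r ^ (2 * H - 2) * (Q (φ θ) (ψ (θ - r)) - Q (φ θ) (ψ θ)))
        + H * (2 * H - 1) * (∫ θ in (0 : ℝ)..t, ∫ r in (0 : ℝ)..θ,
            r ^ (2 * H - 2) * (Q (φ (θ - r)) (ψ θ) - Q (φ θ) (ψ θ))) := by
  exact mainTheorem7_general P d H M γ hH (by linarith) hγ Q hQ2 W hW.isSecondOrderField T t
    ht htT α (NNReal.coe_pos.1 (pos_of_mul_pos_left (by linarith : 0 < (α : ℝ) * γ) hγ.le)) hα
    φ ψ hφ hψ
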